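/- For $e\in[0,1)$ let $u(t,e)$ be the solution of Kepler's equation $u-e\sin u=t$, let $r(t,e)=\frac12(1-e\cos u(t,e))$, and consider the elliptic Sitnikov problem $$\ddot x+F(x,t,e)=0,\qquad F(x,t,e)=\frac{x}{(x^2+r(t,e)^2)^{3/2}}.$$ Let $X(t,\eta,e)$ denote its solution with $x(0)=0$, $\dot x(0)=\eta$. Let $m,p\ge 1$ be integers with $1\le p\le[\sqrt8\,m]$. A family of odd $(m,p)$-periodic solutions is a family $\phi_{m,p}(t,e)=X(t,E(e),e)$, $0\le e<\varepsilon$, where $0<\varepsilon\le1$, $E:[0,\varepsilon)\to\mathbb R$ is smooth ($C^\infty$), $X(m\pi,E(e),e)=0$ for all $e\in[0,\varepsilon)$, $E(0)>0$, and $\phi_{m,p}(\cdot,0)$ has minimal period $2\pi m/p$. Let $\tau_{m,p}(e)=\psi_1(2m\pi,e)+\dot\psi_2(2m\pi,e)$ be the trace of the $2m\pi$-periodic Poincaré matrix of the linearized equation $$\ddot y+\frac{\partial F}{\partial x}(\phi_{m,p}(t,e),t,e)\,y=0,$$ where $\psi_1,\psi_2$ are its solutions with $(\psi_1,\dot\psi_1)(0,e)=(1,0)$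 and $(\psi_2,\dot\psi_2)(0,e)=(0,1)$. **Theorem.** Such a family and its trace exist. If $$\frac pm\notin\Big\{\frac12,\frac14,\frac16,\dots\Big\},$$ then for every such family $\tau_{m,p}$ is differentiable (from the right) at $e=0$ and $\tau_{m,p}'(0)=0$. In particular, $\tau'_{m,p}(0)=0$ whenever $m$ is odd, and whenever $m$ is even and $p\ge m/2+1$. -/

import Mathlib

open Set
open scoped ContDiff

namespace Sitnikov

noncomputable section

/-- The Kepler function `u(t, e)`: the solution `u` of Kepler's equation `u - e sin u = t`
(unique for `0 ≤ e < 1`, see the two lemmas that follow). -/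
def kepler (t e : ℝ) : ℝ := Function.invFun (fun u : ℝ => u - e * Real.sin u) t

theorem kepler_strictMono {e : ℝ} (h0 : 0 ≤ e) (h1 : e < 1) :
    StrictMono (fun u : ℝ => u - e * Real.sin u) := by
  apply strictMono_of_deriv_pos
  intro x
  have h : HasDerivAt (fun u : ℝ => u - e * Real.sin u) (1 - e * Real.cos x) x :=
    (hasDerivAt_id x).sub ((Real.hasDerivAt_sin x).const_mul e)
  rw [h.deriv]
  nlinarith [Real.cos_le_one x]

theorem kepler_spec {e : ℝ} (h0 : 0 ≤ e) (h1 : e < 1) (t : ℝ) :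
    kepler t e - e * Real.sin (kepler t e) = t := by
  have hs : ∃ u : ℝ, (fun u : ℝ => u - e * Real.sin u) u = t := by
    have hc : ContinuousOn (fun u : ℝ => u - e * Real.sin u) (Icc (t - 1) (t + 1)) := by
      fun_prop
    have hi := intermediate_value_Icc (by linarith : t - 1 ≤ t + 1) hc
    obtain ⟨u, -, hu⟩ := hi (show t ∈ _ by
      constructor
      · nlinarith [Real.neg_one_le_sin (t - 1)]
      · nlinarith [Real.sin_le_one (t + 1)])
    exact ⟨u, hu⟩
  exact Function.invFun_eq hs

/-- Half the distance of the primaries, `r(t, e) = r₀ (1 - e cos u(t, e))` with `r₀ = 1/2`. -/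
def r (t e : ℝ) : ℝ := 1 / 2 * (1 - e * Real.cos (kepler t e))

/-- The Sitnikov force `F(x, t, e) = x / (x² + r(t, e)²)^{3/2}`. -/
def F (x t e : ℝ) : ℝ := x / (x ^ 2 + r t e ^ 2) ^ (3 / 2 : ℝ)

/-- `x` is the (global, twice differentiable) solution of the initial value problem
`x'' + g(x, t) = 0`, `x(0) = a`, `x'(0) = v`. -/
structure IsSolutionIVP (g : ℝ → ℝ → ℝ) (a v : ℝ) (x : ℝ → ℝ) : Prop where
  differentiable : Differentiable ℝ x
  equation : ∀ t, HasDerivAt (deriv x) (-g (x t) t) t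
  init_pos : x 0 = a
  init_vel : deriv x 0 = v

/-- `T` is the minimal period of the (nonconstant) function `x`. -/
def IsMinimalPeriod (x : ℝ → ℝ) (T : ℝ) : Prop :=
  IsLeast {s : ℝ | 0 < s ∧ Function.Periodic x s} T

/-- The family `φ(t, e)`, `0 ≤ e < ε`, of odd `(m, p)`-periodic solutions of the Sitnikov problem
that emanates from the odd solution of minimal period `2πm/p` of the circular problem. With
`X(t, η, e)` the solution of `x'' + F(x, t, e) = 0`, `x(0) = 0`, `x'(0) = η`, one has
`φ(t, e) = X(t, E(e), e)`, where `E` is a smooth function on `[0, ε)` such that `E(0) > 0` is the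
initial velocity of that odd solution and `X(mπ, E(e), e) = 0`.
(The symmetries of `F` then make `φ(·, e)` odd and `mπ`-antiperiodic.) -/
structure IsOddFamily (m p : ℕ) (ε : ℝ) (E : ℝ → ℝ) (φ : ℝ → ℝ → ℝ) : Prop where
  eps_pos : 0 < ε
  eps_le_one : ε ≤ 1
  smooth : ContDiffOn ℝ ∞ E (Ico 0 ε)
  solution : ∀ e ∈ Ico 0 ε, IsSolutionIVP (fun x t => F x t e) 0 (E e) (fun t => φ t e)
  boundary : ∀ e ∈ Ico 0 ε, φ (m * Real.pi) e = 0
  velocity_pos : 0 < E 0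
  minimal_period : IsMinimalPeriod (fun t => φ t 0) (2 * m * Real.pi / p)

/-- `τ` is the trace `ψ₁(T) + ψ₂'(T)` of the `T`-periodic Poincaré matrix of Hill's equation
`y'' + q(t) y = 0`, where `ψ₁`, `ψ₂` are its fundamental solutions. -/
def IsHillTrace (q : ℝ → ℝ) (T τ : ℝ) : Prop :=
  ∃ ψ₁ ψ₂ : ℝ → ℝ,
    IsSolutionIVP (fun y t => q t * y) 1 0 ψ₁ ∧
    IsSolutionIVP (fun y t => q t * y) 0 1 ψ₂ ∧
    τ = ψ₁ T + deriv ψ₂ T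

/-- The potential `q(t, e) = ∂F/∂x (φ(t, e), t, e)` of the linearization along `φ(·, e)`. -/
def potential (φ : ℝ → ℝ → ℝ) (e t : ℝ) : ℝ := deriv (fun x => F x t e) (φ t e)

/-- `τ(e)`, `0 ≤ e < ε`, is the trace of the `2mπ`-periodic Poincaré matrix of the linearization
of the Sitnikov problem along `φ(·, e)`. -/
def IsTraceAlong (m : ℕ) (ε : ℝ) (φ : ℝ → ℝ → ℝ) (τ : ℝ → ℝ) : Prop :=
  ∀ e ∈ Ico 0 ε, IsHillTrace (potential φ e) (2 * m * Real.pi) (τ e)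

/-- `τ'_{m,p}(0) = 0`: the trace along the odd `(m, p)`-periodic solutions is differentiable (from
the right, the eccentricity being nonnegative) at `e = 0`, and its derivative there is `0`. -/
def TraceDerivVanishes (m p : ℕ) : Prop :=
  ∀ (ε : ℝ) (E : ℝ → ℝ) (φ : ℝ → ℝ → ℝ) (τ : ℝ → ℝ),
    IsOddFamily m p ε E φ → IsTraceAlong m ε φ τ → HasDerivWithinAt τ 0 (Ici 0) 0

end

end Sitnikov

/-!
At `e = 0` the velocity `ẋ₀` of the circular solution solves the linearized equation, so the
unperturbed Poincaré matrix is unipotent and the first variation of the trace is proportional to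
`∫ (q_e - q₀) ẋ₀²`, where `q_e` is the linearized stiffness along the solution of eccentricity `e`.
By Lagrange's identity this is a multiple of the integral of `ẋ₀` against the explicit time
derivative of the force. Up to `O(e²)`, integration by parts turns the latter into a multiple of
`e ∫ cos t · G(t)` with a function `G` of period `P = mπ/p`, and averaging over the period of `G`
kills the integral unless `P` is a multiple of `2π`.

The circular solutions are found by shooting, with Sturm comparison providing the range of periods.
In the eccentric anomaly the boundary value problem is analytic in `e`, and the implicit function
theorem continues the circular solution; it is nondegenerate because the odd solution of its
linearization does not vanish at multiples of the half period.
-/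

namespace Sitnikov

noncomputable section

open Filter Topology Function
open scoped NNReal Interval

/-! ### Global solutions of Lipschitz equations -/

section GlobalExistence

variable {E : Type*} [NormedAddCommGroup E] [NormedSpace ℝ E]

/-- The weight of Bielecki's norm `sup ‖x t‖ / e^{κ|t|}`. For `κ` larger than the Lipschitz constant
of the equation, Picard iteration contracts this norm on the whole line. -/
def bielecki (κ t : ℝ) : ℝ := Real.exp (κ * |t|)

theorem bielecki_pos (κ t : ℝ) : 0 < bielecki κ t := Real.exp_pos _

theorem one_le_bielecki {κ : ℝ} (hκ : 0 ≤ κ) (t : ℝ) : 1 ≤ bielecki κ t :=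
  Real.one_le_exp (by positivity)

@[fun_prop]
theorem continuous_bielecki (κ : ℝ) : Continuous (bielecki κ) := by
  unfold bielecki
  fun_prop

theorem integral_bielecki_le {κ t : ℝ} (hκ : 0 < κ) (ht : 0 ≤ t) :
    ∫ s in (0 : ℝ)..t, bielecki κ s ≤ bielecki κ t / κ := by
  have hexp : ∀ s, HasDerivAt (fun s => Real.exp (κ * s) / κ) (Real.exp (κ * s)) s := fun s => by
    simpa [hκ.ne'] using (((hasDerivAt_id s).const_mul κ).exp).div_const κ
  calc ∫ s in (0 : ℝ)..t, bielecki κ s = ∫ s in (0 : ℝ)..t, Real.exp (κ * s) :=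
        intervalIntegral.integral_congr fun s hs => by
          rw [uIcc_of_le ht] at hs
          simp only [bielecki, abs_of_nonneg hs.1]
    _ = Real.exp (κ * t) / κ - Real.exp (κ * 0) / κ :=
        intervalIntegral.integral_eq_sub_of_hasDerivAt (fun s _ => hexp s)
          (Continuous.intervalIntegrable (by fun_prop) _ _)
    _ ≤ bielecki κ t / κ := by
        rw [bielecki, abs_of_nonneg ht]
        exact sub_le_self _ (by positivity)

theorem norm_integral_le_bielecki {h : ℝ → E} {κ D : ℝ} (hκ : 0 < κ)
    (hh : ∀ s, ‖h s‖ ≤ D * bielecki κ s) (t : ℝ) :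
    ‖∫ s in (0 : ℝ)..t, h s‖ ≤ D / κ * bielecki κ t := by
  have hD : 0 ≤ D := by
    simpa [bielecki] using (norm_nonneg _).trans (hh 0)
  wlog ht : 0 ≤ t generalizing h t
  · have := this (h := fun s => h (-s)) (fun s => by simpa [bielecki] using hh (-s)) (-t)
      (by linarith)
    rwa [intervalIntegral.integral_comp_neg, neg_neg, neg_zero, intervalIntegral.integral_symm,
      norm_neg, bielecki, abs_neg] at this
  calc ‖∫ s in (0 : ℝ)..t, h s‖ ≤ ∫ s in (0 : ℝ)..t, D * bielecki κ s :=
        intervalIntegral.norm_integral_le_of_norm_le ht (.of_forall fun s _ => hh s)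
          (Continuous.intervalIntegrable (by fun_prop) _ _)
    _ = D * ∫ s in (0 : ℝ)..t, bielecki κ s := intervalIntegral.integral_const_mul _ _
    _ ≤ D * (bielecki κ t / κ) := by gcongr; exact integral_bielecki_le hκ ht
    _ = D / κ * bielecki κ t := by ring

variable {g : ℝ → E → E} {K : ℝ≥0} {κ : ℝ}

theorem continuous_picard (hg : Continuous (uncurry g)) (x₀ : E) {α : ℝ → E}
    (hα : Continuous α) : Continuous (ODE.picard g 0 x₀ α) :=
  continuous_const.add <| intervalIntegral.continuous_primitive
    (fun _ _ => (hg.comp (continuous_id.prodMk hα)).intervalIntegrable _ _) 0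

theorem norm_picard_le (hL : ∀ t, LipschitzWith K (g t)) {C : ℝ} (hC : ∀ t, ‖g t 0‖ ≤ C)
    (hκ : 0 < κ) (x₀ : E) {α : ℝ → E} {B : ℝ} (hα : ∀ s, ‖α s‖ ≤ B * bielecki κ s) (t : ℝ) :
    ‖ODE.picard g 0 x₀ α t‖ ≤ (‖x₀‖ + (C + K * B) / κ) * bielecki κ t := by
  have hC0 : 0 ≤ C := (norm_nonneg _).trans (hC 0)
  have hgα : ∀ s, ‖g s (α s)‖ ≤ (C + K * B) * bielecki κ s := fun s =>
    calc ‖g s (α s)‖ ≤ ‖g s 0‖ + ‖g s (α s) - g s 0‖ := norm_le_norm_add_norm_sub' _ _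
      _ ≤ C * 1 + K * (B * bielecki κ s) := by
          have := (hL s).norm_sub_le (α s) 0
          rw [sub_zero] at this
          exact add_le_add ((hC s).trans_eq (mul_one C).symm) (this.trans (by gcongr; exact hα s))
      _ ≤ (C + K * B) * bielecki κ s := by
          nlinarith [one_le_bielecki hκ.le s]
  calc ‖ODE.picard g 0 x₀ α t‖ ≤ ‖x₀‖ * 1 + (C + K * B) / κ * bielecki κ t := by
        rw [mul_one]
        exact (norm_add_le _ _).trans (by gcongr; exact norm_integral_le_bielecki hκ hgα t)
    _ ≤ (‖x₀‖ + (C + K * B) / κ) * bielecki κ t := by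
        nlinarith [one_le_bielecki hκ.le t, norm_nonneg x₀]

theorem dist_picard_le (hg : Continuous (uncurry g)) (hL : ∀ t, LipschitzWith K (g t)) (hκ : 0 < κ)
    (x₀ : E) {α β : ℝ → E} (hα : Continuous α) (hβ : Continuous β) {D : ℝ}
    (hD : ∀ s, dist (α s) (β s) ≤ D * bielecki κ s) (t : ℝ) :
    dist (ODE.picard g 0 x₀ α t) (ODE.picard g 0 x₀ β t) ≤ K * D / κ * bielecki κ t := by
  have hint {γ : ℝ → E} (hγ : Continuous γ) :
      IntervalIntegrable (fun s => g s (γ s)) MeasureTheory.volume 0 t :=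
    (hg.comp (continuous_id.prodMk hγ)).intervalIntegrable _ _
  rw [ODE.picard_apply, ODE.picard_apply, dist_add_left, dist_eq_norm,
    ← intervalIntegral.integral_sub (hint hα) (hint hβ)]
  refine norm_integral_le_bielecki hκ (fun s => ?_) t
  calc ‖g s (α s) - g s (β s)‖ ≤ K * dist (α s) (β s) := by
        rw [← dist_eq_norm]
        exact (hL s).dist_le_mul _ _
    _ ≤ K * D * bielecki κ s := by
        rw [mul_assoc]
        gcongr
        exact hD s

/-- The function `x` with `‖x t‖ ≤ ‖b‖ e^{κ|t|}` that a bounded continuous function `b` encodes. -/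
def bieleckiSmul (κ : ℝ) (b : BoundedContinuousFunction ℝ E) (s : ℝ) : E := bielecki κ s • b s

theorem continuous_bieleckiSmul (κ : ℝ) (b : BoundedContinuousFunction ℝ E) :
    Continuous (bieleckiSmul κ b) := (continuous_bielecki κ).smul b.continuous

theorem norm_bieleckiSmul_le (κ : ℝ) (b : BoundedContinuousFunction ℝ E) (s : ℝ) :
    ‖bieleckiSmul κ b s‖ ≤ ‖b‖ * bielecki κ s := by
  rw [bieleckiSmul, norm_smul, Real.norm_of_nonneg (bielecki_pos κ s).le, mul_comm]
  gcongr
  exacts [(bielecki_pos κ s).le, b.norm_coe_le_norm s]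

theorem dist_bieleckiSmul_le (κ : ℝ) (b b' : BoundedContinuousFunction ℝ E) (s : ℝ) :
    dist (bieleckiSmul κ b s) (bieleckiSmul κ b' s) ≤ dist b b' * bielecki κ s := by
  rw [bieleckiSmul, bieleckiSmul, dist_smul₀, Real.norm_of_nonneg (bielecki_pos κ s).le, mul_comm]
  gcongr
  exacts [(bielecki_pos κ s).le, BoundedContinuousFunction.dist_coe_le_dist s]

theorem exists_picard_eq_self [CompleteSpace E] (hg : Continuous (uncurry g))
    (hL : ∀ t, LipschitzWith K (g t)) {C : ℝ} (hC : ∀ t, ‖g t 0‖ ≤ C) (x₀ : E) :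
    ∃ x : ℝ → E, Continuous x ∧ ∀ t, x t = ODE.picard g 0 x₀ x t := by
  set κ : ℝ := 2 * K + 1
  have hκ : 0 < κ := by positivity
  let step (b : BoundedContinuousFunction ℝ E) : BoundedContinuousFunction ℝ E :=
    .ofNormedAddCommGroup (fun t => (bielecki κ t)⁻¹ • ODE.picard g 0 x₀ (bieleckiSmul κ b) t)
      (((continuous_bielecki κ).inv₀ fun t => (bielecki_pos κ t).ne').smul
        (continuous_picard hg x₀ (continuous_bieleckiSmul κ b)))
      (‖x₀‖ + (C + K * ‖b‖) / κ) fun t => by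
        rw [norm_smul, norm_inv, Real.norm_of_nonneg (bielecki_pos κ t).le,
          inv_mul_le_iff₀ (bielecki_pos κ t), mul_comm]
        exact norm_picard_le hL hC hκ x₀ (norm_bieleckiSmul_le κ b) t
  have hstep : ContractingWith (1 / 2) step := by
    refine ⟨by rw [← NNReal.coe_lt_coe]; norm_num, LipschitzWith.of_dist_le_mul fun b b' => ?_⟩
    refine (BoundedContinuousFunction.dist_le (by positivity)).2 fun t => ?_
    have hhalf : (K : ℝ) * dist b b' / κ ≤ 1 / 2 * dist b b' := by
      rw [div_le_iff₀ hκ]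
      nlinarith [dist_nonneg (x := b) (y := b')]
    calc dist (step b t) (step b' t)
        = (bielecki κ t)⁻¹ * dist (ODE.picard g 0 x₀ (bieleckiSmul κ b) t)
            (ODE.picard g 0 x₀ (bieleckiSmul κ b') t) := by
          rw [← Real.norm_of_nonneg (inv_nonneg.2 (bielecki_pos κ t).le), ← dist_smul₀]
          rfl
      _ ≤ K * dist b b' / κ := by
          rw [inv_mul_le_iff₀ (bielecki_pos κ t), mul_comm]
          exact dist_picard_le hg hL hκ x₀ (continuous_bieleckiSmul κ b)
            (continuous_bieleckiSmul κ b') (dist_bieleckiSmul_le κ b b') t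
      _ ≤ _ := by simpa using hhalf
  obtain ⟨b, hb⟩ : ∃ b, step b = b := ⟨_, hstep.fixedPoint_isFixedPt⟩
  refine ⟨bieleckiSmul κ b, continuous_bieleckiSmul κ b, fun t => ?_⟩
  calc bieleckiSmul κ b t = bielecki κ t • step b t := by rw [hb, bieleckiSmul]
    _ = ODE.picard g 0 x₀ (bieleckiSmul κ b) t := smul_inv_smul₀ (bielecki_pos κ t).ne' _

theorem exists_hasDerivAt_of_lipschitzWith [CompleteSpace E] (hg : Continuous (uncurry g))
    (hL : ∀ t, LipschitzWith K (g t)) {C : ℝ} (hC : ∀ t, ‖g t 0‖ ≤ C) (x₀ : E) :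
    ∃ x : ℝ → E, x 0 = x₀ ∧ ∀ t, HasDerivAt x (g t (x t)) t := by
  obtain ⟨x, hx, hfix⟩ := exists_picard_eq_self hg hL hC x₀
  have hgx : Continuous fun s => g s (x s) := hg.comp (continuous_id.prodMk hx)
  refine ⟨x, by simp [hfix 0], fun t => ?_⟩
  exact ((hgx.integral_hasStrictDerivAt 0 t).hasDerivAt.const_add x₀).congr_of_eventuallyEq
    (.of_forall hfix)

end GlobalExistence

/-! ### Initial value problems of second order -/

theorem lipschitzWith_phase {g : ℝ → ℝ → ℝ} {K : ℝ≥0} (hL : ∀ t, LipschitzWith K (g · t)) (t : ℝ) :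
    LipschitzWith (max 1 K) fun z : ℝ × ℝ => (z.2, -g z.1 t) :=
  LipschitzWith.prod_snd.prodMk (mul_one K ▸ ((hL t).comp LipschitzWith.prod_fst).neg)

theorem periodic_deriv {f : ℝ → ℝ} {c : ℝ} (h : Periodic f c) : Periodic (deriv f) c := fun t => by
  rw [← deriv_comp_add_const, h.funext]

theorem antiperiodic_deriv {f : ℝ → ℝ} {c : ℝ} (h : Antiperiodic f c) :
    Antiperiodic (deriv f) c := fun t => by
  rw [← deriv_comp_add_const, h.funext, deriv.neg]

theorem lipschitzWith_const_mul_add {c C : ℝ} (hc : |c| ≤ C) (d : ℝ) :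
    LipschitzWith C.toNNReal fun y : ℝ => c * y + d :=
  .of_dist_le' fun x y => by
    rw [dist_add_right, Real.dist_eq, ← mul_sub, abs_mul, Real.dist_eq]
    gcongr

namespace IsSolutionIVP

variable {g h : ℝ → ℝ → ℝ} {K : ℝ≥0} {a v b w : ℝ} {x y : ℝ → ℝ}

theorem hasDerivAt (hx : IsSolutionIVP g a v x) (t : ℝ) : HasDerivAt x (deriv x t) t :=
  (hx.differentiable t).hasDerivAt

theorem continuous (hx : IsSolutionIVP g a v x) : Continuous x := hx.differentiable.continuous

theorem continuous_deriv (hx : IsSolutionIVP g a v x) : Continuous (deriv x) :=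
  continuous_iff_continuousAt.2 fun t => (hx.equation t).continuousAt

theorem hasDerivAt_phase (hx : IsSolutionIVP g a v x) (t : ℝ) :
    HasDerivAt (fun t => (x t, deriv x t)) (deriv x t, -g (x t) t) t :=
  (hx.hasDerivAt t).prodMk (hx.equation t)

theorem continuous_phase (hx : IsSolutionIVP g a v x) : Continuous fun t => (x t, deriv x t) :=
  hx.continuous.prodMk hx.continuous_deriv

theorem of_hasDerivAt (hx : ∀ t, HasDerivAt x (y t) t) (hy : ∀ t, HasDerivAt y (-g (x t) t) t) :
    IsSolutionIVP g (x 0) (y 0) x := by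
  have hxy : deriv x = y := funext fun t => (hx t).deriv
  exact ⟨fun t => (hx t).differentiableAt, by rwa [hxy], rfl, by rw [hxy]⟩

theorem ext_of_eq_at (hL : ∀ t, LipschitzWith K (g · t)) (hx : IsSolutionIVP g a v x)
    (hy : IsSolutionIVP g b w y) {c : ℝ} (hxy : x c = y c) (hxy' : deriv x c = deriv y c) :
    x = y := by
  have hphase := ODE_solution_unique_univ (s := fun _ => univ) (t₀ := c)
    (fun t => (lipschitzWith_phase hL t).lipschitzOnWith)
    (fun t => ⟨hx.hasDerivAt_phase t, mem_univ _⟩) (fun t => ⟨hy.hasDerivAt_phase t, mem_univ _⟩)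
    (by rw [hxy, hxy'])
  exact funext fun t => congrArg Prod.fst (congrFun hphase t)

theorem abs_sub_le (hL : ∀ t, LipschitzWith K (g · t)) (hx : IsSolutionIVP g a v x)
    (hy : IsSolutionIVP h b w y) {T δ ε : ℝ} (hε : 0 ≤ ε)
    (hgh : ∀ t ∈ Icc 0 T, |g (y t) t - h (y t) t| ≤ ε) (ha : |a - b| ≤ δ) (hv : |v - w| ≤ δ)
    {t : ℝ} (ht : t ∈ Icc 0 T) :
    |x t - y t| ≤ (δ + ε) * Real.exp (max 1 K * T) ∧
      |deriv x t - deriv y t| ≤ (δ + ε) * Real.exp (max 1 K * T) := by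
  have hK : (1 : ℝ) ≤ max 1 K := le_max_left _ _
  have hδ : 0 ≤ δ := (abs_nonneg _).trans ha
  have hphase := dist_le_of_approx_trajectories_ODE (a := 0) (b := T) (εf := 0) (εg := ε) (δ := δ)
    (lipschitzWith_phase hL) hx.continuous_phase.continuousOn
    (fun t _ => (hx.hasDerivAt_phase t).hasDerivWithinAt) (fun t _ => (dist_self _).le)
    hy.continuous_phase.continuousOn (fun t _ => (hy.hasDerivAt_phase t).hasDerivWithinAt)
    (fun t ht => by
      rw [Prod.dist_eq, dist_self, dist_comm, dist_neg_neg]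
      exact max_le hε (hgh t (Ico_subset_Icc_self ht)))
    (by simpa only [Prod.dist_eq, Real.dist_eq, hx.init_pos, hx.init_vel, hy.init_pos,
      hy.init_vel] using max_le ha hv) t ht
  rw [← max_le_iff]
  calc max |x t - y t| |deriv x t - deriv y t| ≤ gronwallBound δ ((max 1 K : ℝ≥0) : ℝ) ε t := by
        simpa only [Prod.dist_eq, Real.dist_eq, zero_add, sub_zero] using hphase
    _ = δ * Real.exp (max 1 K * t) + ε / max 1 K * (Real.exp (max 1 K * t) - 1) := by
        rw [gronwallBound_of_K_ne_0 (zero_lt_one.trans_le hK).ne']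
    _ ≤ δ * Real.exp (max 1 K * t) + ε * Real.exp (max 1 K * t) := by
        have hexp : 1 ≤ Real.exp (max 1 K * t) :=
          Real.one_le_exp (mul_nonneg (zero_le_one.trans hK) ht.1)
        gcongr
        exacts [div_le_self hε hK, sub_le_self _ zero_le_one]
    _ ≤ (δ + ε) * Real.exp (max 1 K * T) := by
        rw [← add_mul]
        gcongr
        exact ht.2

theorem comp_add_const (hx : IsSolutionIVP g a v x) (s : ℝ) :
    IsSolutionIVP (fun y t => g y (t + s)) (x s) (deriv x s) fun t => x (t + s) := by
  simpa only [zero_add] using of_hasDerivAt (g := fun y t => g y (t + s))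
    (fun t => (hx.hasDerivAt (t + s)).comp_add_const t s)
    (fun t => (hx.equation (t + s)).comp_add_const t s)

theorem comp_const_sub (hx : IsSolutionIVP g a v x) (s : ℝ) :
    IsSolutionIVP (fun y t => g y (s - t)) (x s) (-deriv x s) fun t => x (s - t) := by
  simpa only [sub_zero] using of_hasDerivAt (g := fun y t => g y (s - t))
    (fun t => (hx.hasDerivAt (s - t)).comp_const_sub s t)
    (fun t => ((hx.equation (s - t)).comp_const_sub s t).fun_neg.congr_deriv (neg_neg _))

theorem neg (hx : IsSolutionIVP g a v x) :
    IsSolutionIVP (fun y t => -g (-y) t) (-a) (-v) fun t => -x t := by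
  rw [← hx.init_pos, ← hx.init_vel]
  exact of_hasDerivAt (fun t => (hx.hasDerivAt t).fun_neg) fun t => by
    simpa only [neg_neg] using (hx.equation t).fun_neg

theorem eq_comp_const_sub (hL : ∀ t, LipschitzWith K (g · t)) (hx : IsSolutionIVP g a v x) {c : ℝ}
    (hg : ∀ y t, g y (2 * c - t) = g y t) (hc : deriv x c = 0) (t : ℝ) : x (2 * c - t) = x t := by
  have hrefl := hx.comp_const_sub (2 * c)
  simp only [hg] at hrefl
  refine congrFun (hrefl.ext_of_eq_at hL hx (c := c) (by ring_nf) ?_) t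
  rw [deriv_comp_const_sub, two_mul, add_sub_cancel_right, hc, neg_zero]

theorem eq_neg_comp_const_sub (hL : ∀ t, LipschitzWith K (g · t)) (hx : IsSolutionIVP g a v x)
    {c : ℝ} (hodd : ∀ y t, g (-y) t = -g y t) (hg : ∀ y t, g y (2 * c - t) = g y t) (hc : x c = 0)
    (t : ℝ) : x (2 * c - t) = -x t := by
  have hrefl := (hx.comp_const_sub (2 * c)).neg
  simp only [hg, hodd, neg_neg] at hrefl
  refine neg_eq_iff_eq_neg.1 (congrFun (hrefl.ext_of_eq_at hL hx (c := c) ?_ ?_) t)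
  · rw [two_mul, add_sub_cancel_right, hc, neg_zero]
  · rw [deriv.fun_neg, deriv_comp_const_sub, two_mul, add_sub_cancel_right, neg_neg]

end IsSolutionIVP

theorem exists_isSolutionIVP {g : ℝ → ℝ → ℝ} {K : ℝ≥0} (hg : Continuous (uncurry g))
    (hL : ∀ t, LipschitzWith K (g · t)) {C : ℝ} (hC : ∀ t, |g 0 t| ≤ C) (a v : ℝ) :
    ∃ x, IsSolutionIVP g a v x := by
  have hphase : Continuous (uncurry fun t (z : ℝ × ℝ) => (z.2, -g z.1 t)) :=
    (continuous_snd.comp continuous_snd).prodMk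
      (hg.comp (by fun_prop : Continuous fun q : ℝ × ℝ × ℝ => (q.2.1, q.1))).neg
  obtain ⟨z, hz0, hz⟩ := exists_hasDerivAt_of_lipschitzWith hphase (lipschitzWith_phase hL)
    (C := C) (fun t => by simpa [Prod.norm_def] using hC t) (a, v)
  have hx := IsSolutionIVP.of_hasDerivAt (g := g) (x := fun t => (z t).1) (y := fun t => (z t).2)
    (fun t => (hasFDerivAt_fst (𝕜 := ℝ) (p := z t)).comp_hasDerivAt t (hz t))
    (fun t => (hasFDerivAt_snd (𝕜 := ℝ) (p := z t)).comp_hasDerivAt t (hz t))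
  rw [hz0] at hx
  exact ⟨_, hx⟩

theorem integral_wronskian {q₀ q₁ y y' z z' f : ℝ → ℝ} (hy : ∀ t, HasDerivAt y (y' t) t)
    (hy' : ∀ t, HasDerivAt y' (-(q₀ t * y t)) t) (hz : ∀ t, HasDerivAt z (z' t) t)
    (hz' : ∀ t, HasDerivAt z' (-(q₁ t * z t + f t)) t) (hq₀ : Continuous q₀) (hq₁ : Continuous q₁)
    (hf : Continuous f) (T : ℝ) :
    ∫ t in (0 : ℝ)..T, ((q₀ t - q₁ t) * y t * z t - f t * y t)
      = (y T * z' T - y' T * z T) - (y 0 * z' 0 - y' 0 * z 0) := by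
  have hyc : Continuous y := continuous_iff_continuousAt.2 fun t => (hy t).continuousAt
  have hzc : Continuous z := continuous_iff_continuousAt.2 fun t => (hz t).continuousAt
  refine intervalIntegral.integral_eq_sub_of_hasDerivAt (f := fun t => y t * z' t - y' t * z t)
    (fun t _ => ?_) (Continuous.intervalIntegrable (by fun_prop) _ _)
  exact (((hy t).mul (hz' t)).sub ((hy' t).mul (hz t))).congr_deriv (by ring)

/-- `y` solves the linear equation `y'' + q(t) y + f(t) = 0` with `y(0) = a`, `y'(0) = v`. -/
abbrev IsLinearSolution (q f : ℝ → ℝ) (a v : ℝ) (y : ℝ → ℝ) : Prop :=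
  IsSolutionIVP (fun y t => q t * y + f t) a v y

/-- `y` solves Hill's equation `y'' + q(t) y = 0` with `y(0) = a`, `y'(0) = v`. -/
abbrev IsHillSolution (q : ℝ → ℝ) (a v : ℝ) (y : ℝ → ℝ) : Prop :=
  IsSolutionIVP (fun y t => q t * y) a v y

theorem exists_isLinearSolution {q f : ℝ → ℝ} {C D : ℝ} (hq : Continuous q)
    (hC : ∀ t, |q t| ≤ C) (hf : Continuous f) (hD : ∀ t, |f t| ≤ D) (a v : ℝ) :
    ∃ y, IsLinearSolution q f a v y :=
  exists_isSolutionIVP (K := C.toNNReal) (by fun_prop)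
    (fun t => lipschitzWith_const_mul_add (hC t) (f t)) (C := D) (by simpa using hD) a v

namespace IsHillSolution

variable {q q₀ q₁ y z : ℝ → ℝ} {a v b w : ℝ}

theorem isLinearSolution (hy : IsHillSolution q a v y) :
    IsLinearSolution q (fun _ => 0) a v y := by
  simpa only [IsLinearSolution, add_zero] using hy

theorem ext_of_eq_at {C : ℝ} (hC : ∀ t, |q t| ≤ C) (hy : IsHillSolution q a v y)
    (hz : IsHillSolution q b w z) {c : ℝ} (hyz : y c = z c) (hyz' : deriv y c = deriv z c) :
    y = z :=
  hy.isLinearSolution.ext_of_eq_at (fun t => lipschitzWith_const_mul_add (hC t) 0)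
    hz.isLinearSolution hyz hyz'

theorem linear_comb (hy : IsHillSolution q a v y) (hz : IsHillSolution q b w z) (c d : ℝ) :
    IsHillSolution q (c * a + d * b) (c * v + d * w) fun t => c * y t + d * z t := by
  rw [← hy.init_pos, ← hy.init_vel, ← hz.init_pos, ← hz.init_vel]
  exact IsSolutionIVP.of_hasDerivAt
    (fun t => ((hy.hasDerivAt t).const_mul c).fun_add ((hz.hasDerivAt t).const_mul d))
    fun t => (((hy.equation t).const_mul c).fun_add ((hz.equation t).const_mul d)).congr_deriv
      (by ring)

theorem integral_sub_mul_mul (hq₀ : Continuous q₀) (hq₁ : Continuous q₁)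
    (hy : IsHillSolution q₀ a v y) (hz : IsHillSolution q₁ b w z) (T : ℝ) :
    ∫ t in (0 : ℝ)..T, (q₀ t - q₁ t) * (y t * z t)
      = (y T * deriv z T - deriv y T * z T) - (a * w - v * b) := by
  rw [← hy.init_pos, ← hy.init_vel, ← hz.init_pos, ← hz.init_vel,
    ← integral_wronskian (f := fun _ => 0) hy.hasDerivAt hy.equation hz.hasDerivAt
      hz.isLinearSolution.equation hq₀ hq₁ continuous_const T]
  simp only [mul_assoc, zero_mul, sub_zero]

end IsHillSolution

/-! ### The Kepler function -/

section Kepler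

variable {e : ℝ} (he : e ∈ Ico (0 : ℝ) 1)
include he

theorem one_sub_mul_cos_pos (u : ℝ) : 0 < 1 - e * Real.cos u := by
  nlinarith [Real.cos_le_one u, he.1, he.2]

theorem kepler_eq_iff {t u : ℝ} : kepler t e = u ↔ u - e * Real.sin u = t := by
  refine ⟨fun h => h ▸ kepler_spec he.1 he.2 t, fun h => ?_⟩
  exact (kepler_strictMono he.1 he.2).injective ((kepler_spec he.1 he.2 t).trans h.symm)

theorem abs_kepler_sub_le (t : ℝ) : |kepler t e - t| ≤ e := by
  rw [show kepler t e - t = e * Real.sin (kepler t e) by linarith [kepler_spec he.1 he.2 t],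
    abs_mul, abs_of_nonneg he.1]
  exact mul_le_of_le_one_right he.1 (Real.abs_sin_le_one _)

theorem kepler_two_mul_pi_sub (m : ℕ) (t : ℝ) :
    kepler (2 * (m * Real.pi) - t) e = 2 * (m * Real.pi) - kepler t e := by
  rw [kepler_eq_iff he, show 2 * (m * Real.pi) = m * (2 * Real.pi) by ring,
    Real.sin_nat_mul_two_pi_sub]
  linarith [kepler_spec he.1 he.2 t]

theorem continuous_kepler : Continuous fun t => kepler t e := by
  let kepler_iso := (kepler_strictMono he.1 he.2).orderIsoOfSurjective _
    fun t => ⟨kepler t e, kepler_spec he.1 he.2 t⟩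
  have h : (fun t => kepler t e) = kepler_iso.symm :=
    funext fun t => (kepler_eq_iff he).2 (kepler_iso.apply_symm_apply t)
  exact h ▸ OrderIso.continuous _

theorem hasDerivAt_kepler (t : ℝ) :
    HasDerivAt (fun t => kepler t e) (1 - e * Real.cos (kepler t e))⁻¹ t := by
  have h : HasDerivAt (fun u : ℝ => u - e * Real.sin u) (1 - e * Real.cos (kepler t e))
      (kepler t e) :=
    (hasDerivAt_id _).sub ((Real.hasDerivAt_sin _).const_mul e)
  exact h.of_local_left_inverse (continuous_kepler he).continuousAt
    (one_sub_mul_cos_pos he _).ne' (.of_forall fun s => kepler_spec he.1 he.2 s)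

theorem r_two_mul_pi_sub (m : ℕ) (t : ℝ) : r (2 * (m * Real.pi) - t) e = r t e := by
  rw [r, r, kepler_two_mul_pi_sub he, show 2 * (m * Real.pi) = m * (2 * Real.pi) by ring,
    Real.cos_nat_mul_two_pi_sub]

theorem half_one_sub_le_r (t : ℝ) : (1 - e) / 2 ≤ r t e := by
  rw [r]
  nlinarith [Real.cos_le_one (kepler t e), he.1]

theorem r_pos (t : ℝ) : 0 < r t e := by
  linarith [half_one_sub_le_r he t, he.2]

theorem continuous_r : Continuous fun t => r t e := by
  have := continuous_kepler he
  unfold r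
  fun_prop

theorem hasDerivAt_r (t : ℝ) :
    HasDerivAt (fun t => r t e) (1 / 4 * e * Real.sin (kepler t e) / r t e) t := by
  refine ((((hasDerivAt_kepler he t).cos.const_mul e).const_sub 1).const_mul (1 / 2)).congr_deriv ?_
  have := one_sub_mul_cos_pos he (kepler t e)
  rw [r]
  field_simp
  ring

end Kepler

theorem zero_mem_Ico_one : (0 : ℝ) ∈ Ico (0 : ℝ) 1 := left_mem_Ico.2 one_pos

theorem kepler_zero_right (t : ℝ) : kepler t 0 = t :=
  (kepler_eq_iff zero_mem_Ico_one).2 (by simp)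

theorem r_zero_right (t : ℝ) : r t 0 = 1 / 2 := by simp [r]

/-! ### The force -/

/-- The inverse distance `(x² + ρ²)^{-1/2}` of the body at height `x` from the primaries. -/
def invDist (x ρ : ℝ) : ℝ := (√(x ^ 2 + ρ ^ 2))⁻¹

/-- The force `x (x² + ρ²)^{-3/2}` towards the primaries when these are at distance `2ρ` from each
other, see `F_eq_force`. -/
def force (x ρ : ℝ) : ℝ := x * invDist x ρ ^ 3

/-- The derivative of `force` with respect to `x`. -/
def stiffness (x ρ : ℝ) : ℝ := invDist x ρ ^ 3 - 3 * x ^ 2 * invDist x ρ ^ 5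

section InvDist

variable {x ρ w : ℝ}

theorem invDist_pos (hρ : 0 < ρ) : 0 < invDist x ρ := by
  unfold invDist
  positivity

theorem invDist_sq_mul (hρ : 0 < ρ) : invDist x ρ ^ 2 * (x ^ 2 + ρ ^ 2) = 1 := by
  rw [invDist, inv_pow, Real.sq_sqrt (by positivity)]
  exact inv_mul_cancel₀ (by positivity)

theorem invDist_eq_of_sq_mul (hw : 0 < w) (h : w ^ 2 * (x ^ 2 + ρ ^ 2) = 1) :
    invDist x ρ = w := by
  rw [invDist, inv_eq_iff_eq_inv, Real.sqrt_eq_iff_eq_sq (by positivity) (by positivity), inv_pow]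
  exact eq_inv_of_mul_eq_one_right h

theorem invDist_neg (x ρ : ℝ) : invDist (-x) ρ = invDist x ρ := by
  rw [invDist, neg_sq, invDist]

theorem invDist_le_inv (hρ : 0 < ρ) : invDist x ρ ≤ ρ⁻¹ :=
  inv_anti₀ hρ (Real.le_sqrt_of_sq_le (by linarith [sq_nonneg x]))

theorem sq_mul_invDist_sq_le_one (hρ : 0 < ρ) : x ^ 2 * invDist x ρ ^ 2 ≤ 1 := by
  nlinarith [invDist_sq_mul (x := x) hρ, sq_nonneg (invDist x ρ * ρ)]

theorem abs_stiffness_le (hρ : 0 < ρ) : |stiffness x ρ| ≤ 2 * ρ⁻¹ ^ 3 := by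
  have hw := invDist_pos (x := x) hρ
  have hratio : |1 - 3 * (x ^ 2 * invDist x ρ ^ 2)| ≤ 2 := by
    have := sq_mul_invDist_sq_le_one (x := x) hρ
    have : 0 ≤ x ^ 2 * invDist x ρ ^ 2 := by positivity
    rw [abs_le]
    constructor <;> linarith
  calc |stiffness x ρ| = |1 - 3 * (x ^ 2 * invDist x ρ ^ 2)| * invDist x ρ ^ 3 := by
        rw [show stiffness x ρ = (1 - 3 * (x ^ 2 * invDist x ρ ^ 2)) * invDist x ρ ^ 3 by
          rw [stiffness]; ring, abs_mul, abs_of_pos (pow_pos hw 3)]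
    _ ≤ 2 * ρ⁻¹ ^ 3 := by
        gcongr
        exact invDist_le_inv hρ

theorem hasDerivAt_invDist {x ρ : ℝ → ℝ} {x' ρ' t : ℝ} (hx : HasDerivAt x x' t)
    (hρ : HasDerivAt ρ ρ' t) (h : 0 < ρ t) :
    HasDerivAt (fun t => invDist (x t) (ρ t))
      (-(x t * x' + ρ t * ρ') * invDist (x t) (ρ t) ^ 3) t := by
  have hpos : 0 < x t ^ 2 + ρ t ^ 2 := by positivity
  have hsqrt : 0 < √(x t ^ 2 + ρ t ^ 2) := by positivity
  refine (((hx.fun_pow 2).fun_add (hρ.fun_pow 2)).sqrt hpos.ne').fun_inv hsqrt.ne' |>.congr_deriv ?_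
  simp only [invDist]
  field_simp
  ring

theorem hasDerivAt_force {x ρ : ℝ → ℝ} {x' ρ' t : ℝ} (hx : HasDerivAt x x' t)
    (hρ : HasDerivAt ρ ρ' t) (h : 0 < ρ t) :
    HasDerivAt (fun t => force (x t) (ρ t))
      (stiffness (x t) (ρ t) * x' - 3 * x t * ρ t * ρ' * invDist (x t) (ρ t) ^ 5) t := by
  refine (hx.mul ((hasDerivAt_invDist hx hρ h).fun_pow 3)).congr_deriv ?_
  simp only [stiffness]
  push_cast
  ring

theorem hasDerivAt_force_left (hρ : 0 < ρ) (x : ℝ) :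
    HasDerivAt (fun x => force x ρ) (stiffness x ρ) x := by
  simpa using hasDerivAt_force (hasDerivAt_id x) (hasDerivAt_const x ρ) hρ

theorem lipschitzWith_force (hρ : 0 < ρ) :
    LipschitzWith (2 * ρ⁻¹ ^ 3).toNNReal fun x => force x ρ :=
  lipschitzWith_of_nnnorm_deriv_le (fun x => (hasDerivAt_force_left hρ x).differentiableAt)
    fun x => by
      rw [(hasDerivAt_force_left hρ x).deriv, ← NNReal.coe_le_coe, coe_nnnorm,
        Real.coe_toNNReal _ (by positivity)]
      exact abs_stiffness_le hρ

end InvDist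

theorem continuous_invDist {X : Type*} [TopologicalSpace X] {x ρ : X → ℝ} (hx : Continuous x)
    (hρ : Continuous ρ) (h : ∀ t, 0 < ρ t) : Continuous fun t => invDist (x t) (ρ t) := by
  unfold invDist
  exact Continuous.inv₀ (by fun_prop) fun t => by
    have := h t
    positivity

theorem continuous_force {X : Type*} [TopologicalSpace X] {x ρ : X → ℝ} (hx : Continuous x)
    (hρ : Continuous ρ) (h : ∀ t, 0 < ρ t) : Continuous fun t => force (x t) (ρ t) :=
  hx.mul ((continuous_invDist hx hρ h).pow 3)

theorem continuous_stiffness {X : Type*} [TopologicalSpace X] {x ρ : X → ℝ} (hx : Continuous x)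
    (hρ : Continuous ρ) (h : ∀ t, 0 < ρ t) : Continuous fun t => stiffness (x t) (ρ t) := by
  have := continuous_invDist hx hρ h
  unfold stiffness
  fun_prop

theorem F_eq_force (x t e : ℝ) : F x t e = force x (r t e) := by
  have h : 0 ≤ x ^ 2 + r t e ^ 2 := by positivity
  have hpow : (x ^ 2 + r t e ^ 2) ^ (3 / 2 : ℝ) = √(x ^ 2 + r t e ^ 2) ^ 3 := by
    rw [Real.sqrt_eq_rpow, ← Real.rpow_mul_natCast h]
    norm_num
  rw [F, force, invDist, inv_pow, hpow, div_eq_mul_inv]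

theorem F_zero_left (t e : ℝ) : F 0 t e = 0 := by simp [F]

theorem F_neg (x t e : ℝ) : F (-x) t e = -F x t e := by simp [F, neg_div]

theorem F_zero_right (x t : ℝ) : F x t 0 = force x (1 / 2) := by
  rw [F_eq_force, r_zero_right]

section Problem

/-- `x` solves the Sitnikov problem with eccentricity `e`, `x(0) = 0` and `x'(0) = η`: this is the
paper's `X(·, η, e)`. -/
abbrev IsSitnikovSolution (e η : ℝ) (x : ℝ → ℝ) : Prop :=
  IsSolutionIVP (fun x t => F x t e) 0 η x

variable {e η : ℝ} {x : ℝ → ℝ}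

theorem F_two_mul_pi_sub (he : e ∈ Ico (0 : ℝ) 1) (m : ℕ) (x t : ℝ) :
    F x (2 * (m * Real.pi) - t) e = F x t e := by
  rw [F_eq_force, F_eq_force, r_two_mul_pi_sub he]

theorem lipschitzWith_F (he : e ∈ Ico (0 : ℝ) 1) (t : ℝ) :
    LipschitzWith (2 * ((1 - e) / 2)⁻¹ ^ 3).toNNReal (F · t e) := by
  have he' : 0 < (1 - e) / 2 := by linarith [he.2]
  simp only [F_eq_force]
  refine (lipschitzWith_force (r_pos he t)).weaken (Real.toNNReal_le_toNNReal ?_)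
  have := r_pos he t
  gcongr
  exact half_one_sub_le_r he t

theorem exists_isSitnikovSolution (he : e ∈ Ico (0 : ℝ) 1) (η : ℝ) :
    ∃ x, IsSitnikovSolution e η x := by
  refine exists_isSolutionIVP ?_ (lipschitzWith_F he) (C := 0) (by simp [F_zero_left]) 0 η
  simp only [uncurry_def, F_eq_force]
  exact continuous_force continuous_fst ((continuous_r he).comp continuous_snd)
    fun q => r_pos he q.2

/-- The factor of the partial derivative `∂F/∂t = -(3/4) e · tide` that carries the dependence on
`x` and `t`. -/
def tide (x t e : ℝ) : ℝ := x * Real.sin (kepler t e) * invDist x (r t e) ^ 5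

theorem hasDerivAt_F_comp (he : e ∈ Ico (0 : ℝ) 1) {x : ℝ → ℝ} {x' t : ℝ}
    (hx : HasDerivAt x x' t) :
    HasDerivAt (fun t => F (x t) t e)
      (stiffness (x t) (r t e) * x' - 3 / 4 * e * tide (x t) t e) t := by
  simp only [F_eq_force]
  have hr := r_pos he t
  refine (hasDerivAt_force hx (hasDerivAt_r he t) hr).congr_deriv ?_
  rw [tide]
  field_simp

theorem potential_eq (he : e ∈ Ico (0 : ℝ) 1) (φ : ℝ → ℝ → ℝ) (t : ℝ) :
    potential φ e t = stiffness (φ t e) (r t e) := by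
  simp only [potential, F_eq_force]
  exact (hasDerivAt_force_left (r_pos he t) _).deriv

namespace IsSitnikovSolution

theorem ext_of_eq_at (he : e ∈ Ico (0 : ℝ) 1) {v w a b : ℝ} {x y : ℝ → ℝ}
    (hx : IsSolutionIVP (fun x t => F x t e) a v x) (hy : IsSolutionIVP (fun x t => F x t e) b w y)
    {c : ℝ} (hxy : x c = y c) (hxy' : deriv x c = deriv y c) : x = y :=
  IsSolutionIVP.ext_of_eq_at (lipschitzWith_F he) hx hy hxy hxy'

theorem two_mul_pi_sub (he : e ∈ Ico (0 : ℝ) 1) (hx : IsSitnikovSolution e η x) {m : ℕ}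
    (hm : x (m * Real.pi) = 0) (t : ℝ) : x (2 * (m * Real.pi) - t) = -x t :=
  hx.eq_neg_comp_const_sub (lipschitzWith_F he) (fun y t => F_neg y t e)
    (F_two_mul_pi_sub he m) hm t

theorem neg_apply (he : e ∈ Ico (0 : ℝ) 1) (hx : IsSitnikovSolution e η x) (t : ℝ) :
    x (-t) = -x t := by
  simpa using hx.two_mul_pi_sub he (m := 0) (by simpa using hx.init_pos) t

theorem periodic (he : e ∈ Ico (0 : ℝ) 1) (hx : IsSitnikovSolution e η x) {m : ℕ}
    (hm : x (m * Real.pi) = 0) : Periodic x (2 * m * Real.pi) := fun t => by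
  have h := hx.two_mul_pi_sub he hm (-t)
  rwa [hx.neg_apply he, neg_neg, sub_neg_eq_add, add_comm, ← mul_assoc] at h

theorem energy (hx : IsSitnikovSolution 0 η x) (t : ℝ) :
    deriv x t ^ 2 / 2 - invDist (x t) (1 / 2) = η ^ 2 / 2 - 2 := by
  have hd t : HasDerivAt (fun t => deriv x t ^ 2 / 2 - invDist (x t) (1 / 2)) 0 t := by
    have hw := hasDerivAt_invDist (hx.hasDerivAt t) (hasDerivAt_const t (1 / 2)) one_half_pos
    refine ((((hx.equation t).fun_pow 2).div_const 2).sub hw).congr_deriv ?_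
    rw [F_zero_right, force]
    push_cast
    ring
  rw [is_const_of_deriv_eq_zero (fun t => (hd t).differentiableAt) (fun t => (hd t).deriv) t 0,
    hx.init_pos, hx.init_vel, invDist_eq_of_sq_mul (w := 2) two_pos (by norm_num)]

theorem deriv_isHillSolution (hx : IsSitnikovSolution 0 η x) :
    IsHillSolution (fun t => stiffness (x t) (1 / 2)) η 0 (deriv x) := by
  have h := IsSolutionIVP.of_hasDerivAt (g := fun y t => stiffness (x t) (1 / 2) * y)
    hx.equation fun t => by
      refine (hasDerivAt_F_comp zero_mem_Ico_one (hx.hasDerivAt t)).fun_neg.congr_deriv ?_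
      rw [r_zero_right]
      ring
  simpa only [hx.init_pos, hx.init_vel, F_zero_left, neg_zero] using h

theorem comp_add_const (hx : IsSitnikovSolution 0 η x) (s : ℝ) :
    IsSolutionIVP (fun x t => F x t 0) (x s) (deriv x s) fun t => x (t + s) := by
  simpa only [F_zero_right] using IsSolutionIVP.comp_add_const hx s

theorem antiperiodic_of_deriv_eq (hx : IsSitnikovSolution 0 η x) {P : ℝ} (hP : x P = 0)
    (hP' : deriv x P = -η) : Antiperiodic x P := by
  have hneg := IsSolutionIVP.neg hx
  simp only [F_neg, neg_neg] at hneg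
  have hshift := hx.comp_add_const P
  refine congrFun (ext_of_eq_at zero_mem_Ico_one hshift hneg (c := 0) ?_ ?_)
  · rw [hshift.init_pos, hneg.init_pos, hP, neg_zero]
  · rw [hshift.init_vel, hneg.init_vel, hP']

theorem periodic_of_deriv_eq (hx : IsSitnikovSolution 0 η x) {P : ℝ} (hP : x P = 0)
    (hP' : deriv x P = η) : Periodic x P := by
  have hshift := hx.comp_add_const P
  refine congrFun (ext_of_eq_at zero_mem_Ico_one hshift hx (c := 0) ?_ ?_)
  · rw [hshift.init_pos, hx.init_pos, hP]
  · rw [hshift.init_vel, hx.init_vel, hP']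

theorem antiperiodic (hx : IsSitnikovSolution 0 η x) {P : ℝ} (hP : IsMinimalPeriod x (2 * P)) :
    Antiperiodic x P := by
  obtain ⟨⟨hpos, hper⟩, hmin⟩ := hP
  have hzero : x P = 0 := by
    have h := hper (-P)
    rw [two_mul, neg_add_cancel_left, hx.neg_apply zero_mem_Ico_one] at h
    linarith
  have henergy : deriv x P ^ 2 = η ^ 2 := by
    have h₀ := hx.energy 0
    rw [hx.init_pos, hx.init_vel, ← hx.energy P, hzero] at h₀
    linarith
  refine hx.antiperiodic_of_deriv_eq hzero
    ((sq_eq_sq_iff_eq_or_eq_neg.1 henergy).resolve_left fun h => ?_)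
  linarith [hmin ⟨by linarith, hx.periodic_of_deriv_eq hzero h⟩]

end IsSitnikovSolution

end Problem

/-! ### Averaging -/

theorem intervalIntegral_eq_zero_of_shift_eq_mul {f : ℝ → ℂ} {T P : ℝ} {c : ℂ} (hT : Periodic f T)
    (hP : ∀ t, f (t + P) = c * f t) (hc : c ≠ 1) : ∫ t in (0 : ℝ)..T, f t = 0 := by
  have hshift : c * ∫ t in (0 : ℝ)..T, f t = ∫ t in (0 : ℝ)..T, f t := by
    rw [← intervalIntegral.integral_const_mul, ← intervalIntegral.integral_congr fun t _ => hP t,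
      intervalIntegral.integral_comp_add_right, zero_add, add_comm]
    simpa only [zero_add] using hT.intervalIntegral_add_eq P 0
  exact (mul_left_eq_self₀.1 hshift).resolve_left hc

theorem integral_cos_mul_eq_zero {G : ℝ → ℝ} (hG : Continuous G) {m : ℕ} {P : ℝ}
    (hT : Periodic G (2 * m * Real.pi)) (hP : Periodic G P) (hcos : Real.cos P ≠ 1) :
    ∫ t in (0 : ℝ)..2 * m * Real.pi, Real.cos t * G t = 0 := by
  let f : ℝ → ℂ := fun t => Complex.exp (t * Complex.I) * G t
  have hf : Continuous f := by fun_prop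
  have hre t : (f t).re = Real.cos t * G t := by
    rw [Complex.re_mul_ofReal, Complex.exp_ofReal_mul_I_re]
  have hshift {s : ℝ} (hs : Periodic G s) (t : ℝ) :
      f (t + s) = Complex.exp (s * Complex.I) * f t := by
    simp only [f, hs t, Complex.ofReal_add, add_mul, Complex.exp_add]
    ring
  have hfT : Periodic f (2 * m * Real.pi) := fun t => by
    rw [hshift hT, show ((2 * m * Real.pi : ℝ) : ℂ) * Complex.I = m * (2 * Real.pi * Complex.I) by
      push_cast; ring, Complex.exp_nat_mul_two_pi_mul_I, one_mul]
  have hc : Complex.exp (P * Complex.I) ≠ 1 := fun h => hcos <| by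
    rw [← Complex.exp_ofReal_mul_I_re, h, Complex.one_re]
  simp_rw [← hre]
  exact (Complex.reCLM.intervalIntegral_comp_comm (hf.intervalIntegrable _ _)).trans
    (congrArg Complex.re (intervalIntegral_eq_zero_of_shift_eq_mul hfT (hshift hP) hc))

theorem IsSitnikovSolution.integral_tide_mul_deriv_eq_zero {η P : ℝ} {m : ℕ} {x : ℝ → ℝ}
    (hx : IsSitnikovSolution 0 η x) (hT : Periodic x (2 * m * Real.pi)) (hP : Antiperiodic x P)
    (hcos : Real.cos P ≠ 1) :
    ∫ t in (0 : ℝ)..2 * m * Real.pi, tide (x t) t 0 * deriv x t = 0 := by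
  let G : ℝ → ℝ := fun t => invDist (x t) (1 / 2) ^ 3
  have hw : Continuous fun t => invDist (x t) (1 / 2) :=
    continuous_invDist hx.continuous continuous_const fun _ => one_half_pos
  have hG : Continuous G := hw.pow 3
  have hGP : Periodic G P := fun t => by simp only [G, hP t, invDist_neg]
  have htide t : tide (x t) t 0 = x t * Real.sin t * invDist (x t) (1 / 2) ^ 5 := by
    rw [tide, kepler_zero_right, r_zero_right]
  have hderiv t : HasDerivAt (fun t => Real.sin t * G t)
      (Real.cos t * G t - 3 * (tide (x t) t 0 * deriv x t)) t := by
    have hwt := hasDerivAt_invDist (hx.hasDerivAt t) (hasDerivAt_const t (1 / 2)) one_half_pos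
    refine ((Real.hasDerivAt_sin t).mul (hwt.fun_pow 3)).congr_deriv ?_
    rw [htide]
    push_cast
    ring
  have htide_cont : Continuous fun t => tide (x t) t 0 := by
    have := hx.continuous
    simp_rw [htide]
    fun_prop
  have hx' := hx.continuous_deriv
  have htotal := intervalIntegral.integral_eq_sub_of_hasDerivAt (a := 0) (b := 2 * m * Real.pi)
    (fun t _ => hderiv t) (Continuous.intervalIntegrable (by fun_prop) _ _)
  rw [intervalIntegral.integral_sub (Continuous.intervalIntegrable (by fun_prop) _ _)
    (Continuous.intervalIntegrable (by fun_prop) _ _), intervalIntegral.integral_const_mul,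
    integral_cos_mul_eq_zero hG (fun t => by simp only [G, hT t]) hGP hcos,
    show Real.sin (2 * m * Real.pi) = 0 by exact_mod_cast Real.sin_nat_mul_pi (2 * m),
    Real.sin_zero] at htotal
  linarith

/-! ### First order expansions in the eccentricity -/

/-- The filter of eccentricities `e → 0⁺`, uniformly in `t ∈ [0, T]`. -/
abbrev strip (T : ℝ) : Filter (ℝ × ℝ) := 𝓝[≥] 0 ×ˢ 𝓟 (Icc 0 T)

/-- `f(e, t) = f(0, t) + O(e)` as `e → 0⁺`, uniformly in `t ∈ [0, T]`, with `f(0, ·)` bounded. -/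
structure LipAtZero (T : ℝ) (f : ℝ → ℝ → ℝ) : Prop where
  bounded : (fun z : ℝ × ℝ => f 0 z.2) =O[strip T] fun _ => (1 : ℝ)
  isBigO_sub : (fun z : ℝ × ℝ => f z.1 z.2 - f 0 z.2) =O[strip T] Prod.fst

theorem isBigO_intervalIntegral {l : Filter ℝ} {T : ℝ} (hT : 0 ≤ T) {f : ℝ → ℝ → ℝ} {g : ℝ → ℝ}
    (h : (fun z : ℝ × ℝ => f z.1 z.2) =O[l ×ˢ 𝓟 (Icc 0 T)] fun z => g z.1) :
    (fun e => ∫ t in (0 : ℝ)..T, f e t) =O[l] g := by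
  obtain ⟨C, hC⟩ := h.bound
  refine .of_bound (C * T) ?_
  filter_upwards [eventually_prod_principal_iff.1 hC] with e he
  have hint := intervalIntegral.norm_integral_le_of_norm_le_const (a := 0) (b := T) (f := f e)
    fun t ht => he t (Ioc_subset_Icc_self (uIoc_of_le hT ▸ ht))
  rwa [sub_zero, abs_of_nonneg hT, mul_right_comm] at hint

namespace LipAtZero

variable {T : ℝ} {f g : ℝ → ℝ → ℝ}

theorem isBigO_one (hf : LipAtZero T f) :
    (fun z : ℝ × ℝ => f z.1 z.2) =O[strip T] fun _ => (1 : ℝ) := by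
  have hfst : (Prod.fst : ℝ × ℝ → ℝ) =O[strip T] fun _ => (1 : ℝ) :=
    (tendsto_fst.mono_right nhdsWithin_le_nhds).isBigO_one ℝ
  simpa only [sub_add_cancel] using (hf.isBigO_sub.trans hfst).add hf.bounded

theorem of_continuous {c : ℝ → ℝ} (hc : Continuous c) : LipAtZero T fun _ => c := by
  obtain ⟨C, hC⟩ := isCompact_Icc.exists_bound_of_continuousOn (s := Icc 0 T) hc.continuousOn
  refine ⟨.of_bound C (eventually_prod_principal_iff.2 (.of_forall fun _ t ht => ?_)), ?_⟩
  · simpa only [norm_one, mul_one] using hC t ht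
  · exact (Asymptotics.isBigO_zero Prod.fst _).congr_left fun _ => (sub_self _).symm

theorem param : LipAtZero T fun e _ => e :=
  ⟨Asymptotics.isBigO_zero _ _,
    (Asymptotics.isBigO_refl _ _).congr_left fun z => (sub_zero z.1).symm⟩

theorem add (hf : LipAtZero T f) (hg : LipAtZero T g) : LipAtZero T fun e t => f e t + g e t :=
  ⟨hf.bounded.add hg.bounded, (hf.isBigO_sub.add hg.isBigO_sub).congr_left fun _ => by ring⟩

theorem mul (hf : LipAtZero T f) (hg : LipAtZero T g) : LipAtZero T fun e t => f e t * g e t := by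
  refine ⟨(hf.bounded.mul hg.bounded).congr_right fun _ => one_mul 1, ?_⟩
  have hleft := (hf.isBigO_sub.mul hg.isBigO_one).congr_right fun z => mul_one z.1
  have hright := (hf.bounded.mul hg.isBigO_sub).congr_right fun z => one_mul z.1
  exact (hleft.add hright).congr_left fun _ => by ring

theorem const_mul (hf : LipAtZero T f) (c : ℝ) : LipAtZero T fun e t => c * f e t :=
  (of_continuous continuous_const).mul hf

theorem sub (hf : LipAtZero T f) (hg : LipAtZero T g) : LipAtZero T fun e t => f e t - g e t := by
  simpa only [neg_one_mul, ← sub_eq_add_neg] using hf.add (hg.const_mul (-1))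

theorem pow (hf : LipAtZero T f) (n : ℕ) : LipAtZero T fun e t => f e t ^ n := by
  induction n with
  | zero => simpa only [pow_zero] using of_continuous continuous_const
  | succ n ih => simpa only [pow_succ] using ih.mul hf

theorem comp_lipschitzWith (hf : LipAtZero T f) {φ : ℝ → ℝ} {K : ℝ≥0} (hφ : LipschitzWith K φ) :
    LipAtZero T fun e t => φ (f e t) := by
  have hsub (f₁ f₂ : ℝ × ℝ → ℝ) :
      (fun z => φ (f₁ z) - φ (f₂ z)) =O[strip T] fun z => f₁ z - f₂ z :=
    .of_bound K (.of_forall fun z => by simpa only [dist_eq_norm] using hφ.dist_le_mul _ _)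
  refine ⟨?_, (hsub _ _).trans hf.isBigO_sub⟩
  have hzero := (hsub (fun z => f 0 z.2) 0).trans (hf.bounded.congr_left fun _ => (sub_zero _).symm)
  simpa only [Pi.zero_apply, sub_add_cancel] using
    hzero.add (Asymptotics.isBigO_const_const (φ 0) one_ne_zero (strip T))

theorem integral_sub_mul_sub (hT : 0 ≤ T) (hf : LipAtZero T f) (hg : LipAtZero T g) :
    (fun e => ∫ t in (0 : ℝ)..T, (f e t - f 0 t) * (g e t - g 0 t)) =O[𝓝[≥] 0] fun e => e ^ 2 :=
  isBigO_intervalIntegral hT ((hf.isBigO_sub.mul hg.isBigO_sub).congr_right fun z => (sq z.1).symm)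

theorem solution {g : ℝ → ℝ → ℝ → ℝ} {K : ℝ≥0} {a v : ℝ → ℝ} {x : ℝ → ℝ → ℝ}
    (hx : ∀ᶠ e in 𝓝[≥] 0, IsSolutionIVP (g e) (a e) (v e) (x e))
    (hL : ∀ᶠ e in 𝓝[≥] 0, ∀ t, LipschitzWith K (g e · t))
    (ha : (fun e => a e - a 0) =O[𝓝[≥] 0] fun e => e)
    (hv : (fun e => v e - v 0) =O[𝓝[≥] 0] fun e => e)
    (hg : LipAtZero T fun e t => g e (x 0 t) t) :
    LipAtZero T x ∧ LipAtZero T fun e => deriv (x e) := by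
  have hx0 := hx.self_of_nhdsWithin (mem_Ici.2 le_rfl)
  obtain ⟨A, hA0, hA⟩ := ha.exists_nonneg
  obtain ⟨V, hV0, hV⟩ := hv.exists_nonneg
  obtain ⟨D, hD0, hD⟩ := hg.isBigO_sub.exists_nonneg
  have hest : ∀ᶠ e in 𝓝[≥] 0, ∀ t ∈ Icc 0 T,
      |x e t - x 0 t| ≤ (A + V + D) * Real.exp (max 1 K * T) * |e| ∧
        |deriv (x e) t - deriv (x 0) t| ≤ (A + V + D) * Real.exp (max 1 K * T) * |e| := by
    filter_upwards [hx, hL, hA.bound, hV.bound, eventually_prod_principal_iff.1 hD.bound]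
      with e hxe hLe hAe hVe hDe t ht
    have h := hxe.abs_sub_le hLe hx0 (δ := (A + V) * |e|) (by positivity) hDe
      (hAe.trans (by rw [Real.norm_eq_abs]; gcongr; linarith))
      (hVe.trans (by rw [Real.norm_eq_abs]; gcongr; linarith)) ht
    rwa [Real.norm_eq_abs, ← add_mul, mul_right_comm] at h
  exact ⟨⟨(of_continuous hx0.continuous).bounded, .of_bound _ (eventually_prod_principal_iff.2
      (hest.mono fun e he t ht => (he t ht).1))⟩,
    ⟨(of_continuous hx0.continuous_deriv).bounded, .of_bound _ (eventually_prod_principal_iff.2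
      (hest.mono fun e he t ht => (he t ht).2))⟩⟩

end LipAtZero

theorem abs_invDist_sub_le {x y ρ σ c : ℝ} (hc : 0 < c) (hρ : c ≤ ρ) (hσ : c ≤ σ) :
    |invDist x ρ - invDist y σ| ≤ c⁻¹ ^ 2 * (|x - y| + |ρ - σ|) := by
  have hinv {x ρ : ℝ} : invDist x ρ = ‖(⟨x, ρ⟩ : ℂ)‖⁻¹ := by
    rw [Complex.norm_eq_sqrt_sq_add_sq, invDist]
  have hle {x ρ : ℝ} (hρ : c ≤ ρ) : invDist x ρ ≤ c⁻¹ :=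
    (invDist_le_inv (hc.trans_le hρ)).trans (inv_anti₀ hc hρ)
  have hpos {x ρ : ℝ} (hρ : c ≤ ρ) : 0 < invDist x ρ := invDist_pos (hc.trans_le hρ)
  set p : ℂ := ⟨x, ρ⟩
  set q : ℂ := ⟨y, σ⟩
  have hp : 0 < ‖p‖ := inv_pos.1 (hinv ▸ hpos hρ)
  have hq : 0 < ‖q‖ := inv_pos.1 (hinv ▸ hpos hσ)
  calc |invDist x ρ - invDist y σ| = invDist x ρ * invDist y σ * |‖q‖ - ‖p‖| := by
        rw [← abs_of_pos (mul_pos (hpos hρ) (hpos hσ)), ← abs_mul, hinv, hinv]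
        congr 1
        change ‖p‖⁻¹ - ‖q‖⁻¹ = ‖p‖⁻¹ * ‖q‖⁻¹ * (‖q‖ - ‖p‖)
        field_simp
    _ ≤ c⁻¹ * c⁻¹ * ‖q - p‖ := by
        have := hpos (x := y) hσ
        gcongr
        exacts [hle hρ, hle hσ, abs_norm_sub_norm_le q p]
    _ ≤ c⁻¹ ^ 2 * (|x - y| + |ρ - σ|) := by
        rw [sq, norm_sub_rev]
        gcongr
        exact Complex.norm_le_abs_re_add_abs_im (p - q)

theorem LipAtZero.invDist {T c : ℝ} {x ρ : ℝ → ℝ → ℝ} (hx : LipAtZero T x) (hρ : LipAtZero T ρ)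
    (hc : 0 < c) (h : ∀ᶠ e in 𝓝[≥] 0, ∀ t, c ≤ ρ e t) :
    LipAtZero T fun e t => invDist (x e t) (ρ e t) := by
  have h0 := h.self_of_nhdsWithin (mem_Ici.2 le_rfl)
  refine ⟨.of_bound c⁻¹ (.of_forall fun z => ?_), .trans (.of_bound (c⁻¹ ^ 2) ?_)
    (hx.isBigO_sub.abs_left.add hρ.isBigO_sub.abs_left)⟩
  · rw [norm_one, mul_one, Real.norm_of_nonneg (invDist_pos (hc.trans_le (h0 _))).le]
    exact (invDist_le_inv (hc.trans_le (h0 _))).trans (inv_anti₀ hc (h0 _))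
  · filter_upwards [h.prod_inl _] with z hz
    exact (abs_invDist_sub_le hc (hz _) (h0 _)).trans (by gcongr; exact le_abs_self _)

theorem eventually_mem_Icc_half : ∀ᶠ e : ℝ in 𝓝[≥] 0, e ∈ Icc (0 : ℝ) (1 / 2) :=
  Icc_mem_nhdsGE one_half_pos

theorem mem_Ico_one_of_mem_Icc_half {e : ℝ} (he : e ∈ Icc (0 : ℝ) (1 / 2)) : e ∈ Ico (0 : ℝ) 1 :=
  ⟨he.1, he.2.trans_lt one_half_lt_one⟩

theorem one_fourth_le_r {e : ℝ} (he : e ∈ Icc (0 : ℝ) (1 / 2)) (t : ℝ) : 1 / 4 ≤ r t e := by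
  linarith [half_one_sub_le_r (mem_Ico_one_of_mem_Icc_half he) t, he.2]

theorem lipAtZero_kepler (T : ℝ) : LipAtZero T fun e t => kepler t e := by
  refine ⟨by simpa only [kepler_zero_right] using (LipAtZero.of_continuous continuous_id').bounded,
    .of_bound 1 ?_⟩
  filter_upwards [eventually_mem_Icc_half.prod_inl _] with z hz
  rw [kepler_zero_right, one_mul, Real.norm_of_nonneg hz.1]
  exact abs_kepler_sub_le (mem_Ico_one_of_mem_Icc_half hz) z.2

theorem lipAtZero_r (T : ℝ) : LipAtZero T fun e t => r t e :=
  have hcos := (lipAtZero_kepler T).comp_lipschitzWith Real.lipschitzWith_cos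
  ((LipAtZero.of_continuous continuous_const).sub (LipAtZero.param.mul hcos)).const_mul (1 / 2)

section AlongSolution

variable {T : ℝ} {x : ℝ → ℝ → ℝ}

theorem LipAtZero.invDist_r (hx : LipAtZero T x) :
    LipAtZero T fun e t => Sitnikov.invDist (x e t) (r t e) :=
  hx.invDist (lipAtZero_r T) (c := 1 / 4) (by norm_num)
    (eventually_mem_Icc_half.mono fun _ => one_fourth_le_r)

theorem LipAtZero.stiffness (hx : LipAtZero T x) :
    LipAtZero T fun e t => Sitnikov.stiffness (x e t) (r t e) :=
  (hx.invDist_r.pow 3).sub (((hx.pow 2).const_mul 3).mul (hx.invDist_r.pow 5))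

theorem LipAtZero.tide (hx : LipAtZero T x) : LipAtZero T fun e t => Sitnikov.tide (x e t) t e :=
  (hx.mul ((lipAtZero_kepler T).comp_lipschitzWith Real.lipschitzWith_sin)).mul (hx.invDist_r.pow 5)

theorem LipAtZero.force (hx : LipAtZero T x) : LipAtZero T fun e t => F (x e t) t e := by
  simpa only [F_eq_force, Sitnikov.force] using hx.mul (hx.invDist_r.pow 3)

end AlongSolution

/-! ### The trace of the Poincaré matrix -/

theorem integral_sub_mul_isBigO_iff {T : ℝ} (hT : 0 ≤ T) {q y : ℝ → ℝ → ℝ} (hq : LipAtZero T q)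
    (hy : LipAtZero T y) (hqc : ∀ᶠ e in 𝓝[≥] 0, Continuous (q e))
    (hyc : ∀ᶠ e in 𝓝[≥] 0, Continuous (y e)) :
    ((fun e => ∫ t in (0 : ℝ)..T, (q e t - q 0 t) * y e t) =O[𝓝[≥] 0] fun e => e ^ 2) ↔
      (fun e => ∫ t in (0 : ℝ)..T, (q e t - q 0 t) * y 0 t) =O[𝓝[≥] 0] fun e => e ^ 2 := by
  have hdiff : (fun e => (∫ t in (0 : ℝ)..T, (q e t - q 0 t) * y e t) -
      ∫ t in (0 : ℝ)..T, (q e t - q 0 t) * y 0 t) =O[𝓝[≥] 0] fun e => e ^ 2 := by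
    refine (hq.integral_sub_mul_sub hT hy).congr' ?_ .rfl
    have hq0 := hqc.self_of_nhdsWithin (mem_Ici.2 le_rfl)
    have hy0 := hyc.self_of_nhdsWithin (mem_Ici.2 le_rfl)
    filter_upwards [hqc, hyc] with e hqe hye
    simp_rw [mul_sub]
    exact intervalIntegral.integral_sub (Continuous.intervalIntegrable (by fun_prop) _ _)
      (Continuous.intervalIntegrable (by fun_prop) _ _)
  exact ⟨fun h => (h.sub hdiff).congr_left fun _ => by ring,
    fun h => (hdiff.add h).congr_left fun _ => by ring⟩

theorem trace_sub_two {q₀ q₁ y₁ y₂ z₁ z₂ : ℝ → ℝ} {T : ℝ} (hq₀ : Continuous q₀)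
    (hq₁ : Continuous q₁) (hy₁ : IsHillSolution q₀ 1 0 y₁) (hy₂ : IsHillSolution q₀ 0 1 y₂)
    (hz₁ : IsHillSolution q₁ 1 0 z₁) (hz₂ : IsHillSolution q₁ 0 1 z₂) (hT : y₁ T = 1)
    (hT' : deriv y₁ T = 0) :
    z₁ T + deriv z₂ T - 2
      = -(y₂ T * ∫ t in (0 : ℝ)..T, (q₁ t - q₀ t) * (y₁ t * z₁ t))
        - ∫ t in (0 : ℝ)..T, (q₁ t - q₀ t) * (y₁ t * z₂ t - y₂ t * z₁ t) := by
  have hy₁c := hy₁.continuous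
  have hy₂c := hy₂.continuous
  have hz₁c := hz₁.continuous
  have hz₂c := hz₂.continuous
  have hneg (f : ℝ → ℝ) : ∫ t in (0 : ℝ)..T, (q₁ t - q₀ t) * f t
      = -∫ t in (0 : ℝ)..T, (q₀ t - q₁ t) * f t := by
    rw [← intervalIntegral.integral_neg]
    congr 1
    ext t
    ring
  have hdet : deriv y₂ T = 1 := by
    have h := hy₁.integral_sub_mul_mul hq₀ hq₀ hy₂ T
    simp only [sub_self, zero_mul, intervalIntegral.integral_zero, hT, hT'] at h
    linarith
  simp_rw [hneg, mul_sub]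
  rw [intervalIntegral.integral_sub (Continuous.intervalIntegrable (by fun_prop) _ _)
    (Continuous.intervalIntegrable (by fun_prop) _ _), hy₁.integral_sub_mul_mul hq₀ hq₁ hz₁,
    hy₁.integral_sub_mul_mul hq₀ hq₁ hz₂, hy₂.integral_sub_mul_mul hq₀ hq₁ hz₁, hT, hT', hdet]
  ring

theorem LipAtZero.hillSolution {T C a v : ℝ} {q ψ : ℝ → ℝ → ℝ} (hq : LipAtZero T q)
    (hqC : ∀ᶠ e in 𝓝[≥] 0, ∀ t, |q e t| ≤ C)
    (hψ : ∀ᶠ e in 𝓝[≥] 0, IsHillSolution (q e) a v (ψ e)) : LipAtZero T ψ :=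
  have hψ0 := hψ.self_of_nhdsWithin (mem_Ici.2 le_rfl)
  (LipAtZero.solution (a := fun _ => a) (v := fun _ => v) (K := C.toNNReal) hψ
    (hqC.mono fun e he t => by simpa only [add_zero] using lipschitzWith_const_mul_add (he t) 0)
    (by simpa only [sub_self] using Asymptotics.isBigO_zero _ _)
    (by simpa only [sub_self] using Asymptotics.isBigO_zero _ _)
    (hq.mul (.of_continuous hψ0.continuous))).1

theorem isBigO_trace_sub_two {T C : ℝ} (hT : 0 ≤ T) {q ψ₁ ψ₂ : ℝ → ℝ → ℝ} (hq : LipAtZero T q)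
    (hqc : ∀ᶠ e in 𝓝[≥] 0, Continuous (q e)) (hqC : ∀ᶠ e in 𝓝[≥] 0, ∀ t, |q e t| ≤ C)
    (h₁ : ∀ᶠ e in 𝓝[≥] 0, IsHillSolution (q e) 1 0 (ψ₁ e))
    (h₂ : ∀ᶠ e in 𝓝[≥] 0, IsHillSolution (q e) 0 1 (ψ₂ e))
    (hψT : ψ₁ 0 T = 1) (hψT' : deriv (ψ₁ 0) T = 0)
    (hvar : (fun e => ∫ t in (0 : ℝ)..T, (q e t - q 0 t) * ψ₁ 0 t ^ 2)
      =O[𝓝[≥] 0] fun e => e ^ 2) :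
    (fun e => ψ₁ e T + deriv (ψ₂ e) T - 2) =O[𝓝[≥] 0] fun e => e ^ 2 := by
  have h₁0 := h₁.self_of_nhdsWithin (mem_Ici.2 le_rfl)
  have h₂0 := h₂.self_of_nhdsWithin (mem_Ici.2 le_rfl)
  have hψ₁ : LipAtZero T ψ₁ := hq.hillSolution hqC h₁
  have hψ₂ : LipAtZero T ψ₂ := hq.hillSolution hqC h₂
  have hψ₁0 : LipAtZero T fun _ => ψ₁ 0 := .of_continuous h₁0.continuous
  have hψ₂0 : LipAtZero T fun _ => ψ₂ 0 := .of_continuous h₂0.continuous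
  have hsquare := (integral_sub_mul_isBigO_iff hT hq (hψ₁0.mul hψ₁) hqc
    (h₁.mono fun e he => h₁0.continuous.mul he.continuous)).2 (by simpa only [← sq] using hvar)
  have hcross := (integral_sub_mul_isBigO_iff hT hq ((hψ₁0.mul hψ₂).sub (hψ₂0.mul hψ₁)) hqc
    ((h₁.and h₂).mono fun e he => (h₁0.continuous.mul he.2.continuous).sub
      (h₂0.continuous.mul he.1.continuous))).2 <| by
    simpa only [mul_comm (ψ₂ 0 _), sub_self, mul_zero, intervalIntegral.integral_zero] using
      Asymptotics.isBigO_zero _ _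
  refine ((hsquare.const_mul_left (ψ₂ 0 T)).neg_left.sub hcross).congr' ?_ .rfl
  filter_upwards [hqc, h₁, h₂] with e hqe h₁e h₂e
  exact (trace_sub_two (hqc.self_of_nhdsWithin (mem_Ici.2 le_rfl)) hqe h₁0 h₂0 h₁e h₂e hψT
    hψT').symm

/-! ### The trace along the odd periodic solutions -/

namespace IsSitnikovSolution

theorem continuous_stiffness {e η : ℝ} {x : ℝ → ℝ} (he : e ∈ Ico (0 : ℝ) 1)
    (hx : IsSitnikovSolution e η x) : Continuous fun t => stiffness (x t) (r t e) :=
  Sitnikov.continuous_stiffness hx.continuous (continuous_r he) (r_pos he)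

theorem continuous_tide {e η : ℝ} {x : ℝ → ℝ} (he : e ∈ Ico (0 : ℝ) 1)
    (hx : IsSitnikovSolution e η x) : Continuous fun t => tide (x t) t e := by
  have := hx.continuous
  have := continuous_kepler he
  have := continuous_invDist hx.continuous (continuous_r he) (r_pos he)
  unfold tide
  fun_prop

theorem integral_stiffness_sub_mul {e η η₀ T : ℝ} {x y : ℝ → ℝ} (he : e ∈ Ico (0 : ℝ) 1)
    (hx : IsSitnikovSolution e η x) (hy : IsSitnikovSolution 0 η₀ y) (hxT : x T = 0)
    (hyT : y T = 0) :
    ∫ t in (0 : ℝ)..T, (stiffness (x t) (r t e) - stiffness (y t) (r t 0)) *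
        (deriv y t * deriv x t)
      = 3 / 4 * ∫ t in (0 : ℝ)..T, (e - 0) * (tide (x t) t e * deriv y t) := by
  have hqx := hx.continuous_stiffness he
  have hqy := hy.continuous_stiffness zero_mem_Ico_one
  have htide := hx.continuous_tide he
  have hx' := hx.continuous_deriv
  have hy' := hy.continuous_deriv
  -- the boundary terms vanish, since `x'' = -F(x) = 0` and `y'' = 0` at both ends
  have hlagrange := integral_wronskian (f := fun t => -(3 / 4) * e * tide (x t) t e) hy.equation
    (fun t => (hasDerivAt_F_comp zero_mem_Ico_one (hy.hasDerivAt t)).fun_neg.congr_deriv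
      (by rw [mul_zero, zero_mul, sub_zero]))
    hx.equation (fun t => (hasDerivAt_F_comp he (hx.hasDerivAt t)).fun_neg.congr_deriv (by ring))
    hqy hqx (by fun_prop) T
  simp only [hxT, hyT, hx.init_pos, hy.init_pos, F_zero_left, neg_zero, mul_zero, zero_mul,
    sub_zero] at hlagrange
  rw [← sub_eq_zero, ← intervalIntegral.integral_const_mul, ← intervalIntegral.integral_sub
    (Continuous.intervalIntegrable (by fun_prop) _ _)
    (Continuous.intervalIntegrable (by fun_prop) _ _), ← neg_eq_zero,
    ← intervalIntegral.integral_neg]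
  refine Eq.trans ?_ hlagrange
  congr 1
  ext t
  ring

theorem deriv_eq_mul {η : ℝ} {x ψ : ℝ → ℝ} (hx : IsSitnikovSolution 0 η x)
    (hψ : IsHillSolution (fun t => stiffness (x t) (1 / 2)) 1 0 ψ) (t : ℝ) :
    deriv x t = η * ψ t := by
  have hmul := hψ.linear_comb hψ η 0
  have heq := hx.deriv_isHillSolution.ext_of_eq_at (fun t => abs_stiffness_le one_half_pos) hmul
    (c := 0) (by rw [hmul.init_pos, hx.init_vel]; ring)
    (by rw [hmul.init_vel, hx.deriv_isHillSolution.init_vel]; ring)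
  simpa only [zero_mul, add_zero] using congrFun heq t

theorem periodic_of_isHillSolution {η T : ℝ} {x ψ : ℝ → ℝ} (hx : IsSitnikovSolution 0 η x)
    (hη : η ≠ 0) (hT : Periodic x T)
    (hψ : IsHillSolution (fun t => stiffness (x t) (1 / 2)) 1 0 ψ) : Periodic ψ T := fun t => by
  have hderiv := periodic_deriv hT t
  rw [hx.deriv_eq_mul hψ, hx.deriv_eq_mul hψ] at hderiv
  exact mul_left_cancel₀ hη hderiv

end IsSitnikovSolution

section Family

variable {η : ℝ → ℝ} {x : ℝ → ℝ → ℝ}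

theorem lipAtZero_of_isSitnikovSolution {T : ℝ}
    (hx : ∀ᶠ e in 𝓝[≥] 0, IsSitnikovSolution e (η e) (x e))
    (hη : (fun e => η e - η 0) =O[𝓝[≥] 0] fun e => e) :
    LipAtZero T x ∧ LipAtZero T fun e => deriv (x e) := by
  refine LipAtZero.solution (a := fun _ => 0) (K := (2 * (1 / 4 : ℝ)⁻¹ ^ 3).toNNReal) hx ?_
    (by simpa only [sub_self] using Asymptotics.isBigO_zero _ _) hη
    (LipAtZero.of_continuous (hx.self_of_nhdsWithin (mem_Ici.2 le_rfl)).continuous).force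
  filter_upwards [eventually_mem_Icc_half] with e he t
  refine (lipschitzWith_F (mem_Ico_one_of_mem_Icc_half he) t).weaken
    (Real.toNNReal_le_toNNReal ?_)
  have : 1 / 4 ≤ (1 - e) / 2 := by linarith [he.2]
  gcongr

theorem isBigO_integral_stiffness_sub {m : ℕ} {P : ℝ}
    (hx : ∀ᶠ e in 𝓝[≥] 0, IsSitnikovSolution e (η e) (x e))
    (hη : (fun e => η e - η 0) =O[𝓝[≥] 0] fun e => e)
    (hxm : ∀ᶠ e in 𝓝[≥] 0, x e (m * Real.pi) = 0) (hP : Antiperiodic (x 0) P)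
    (hcos : Real.cos P ≠ 1) :
    (fun e => ∫ t in (0 : ℝ)..2 * m * Real.pi,
      (stiffness (x e t) (r t e) - stiffness (x 0 t) (r t 0)) * deriv (x 0) t ^ 2)
      =O[𝓝[≥] 0] fun e => e ^ 2 := by
  obtain ⟨hl, hl'⟩ := lipAtZero_of_isSitnikovSolution (T := 2 * m * Real.pi) hx hη
  have hx0 := hx.self_of_nhdsWithin (mem_Ici.2 le_rfl)
  have hper0 := hx0.periodic zero_mem_Ico_one (hxm.self_of_nhdsWithin (mem_Ici.2 le_rfl))
  have hx0' : LipAtZero (2 * m * Real.pi) fun _ => deriv (x 0) :=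
    .of_continuous hx0.continuous_deriv
  have hT : 0 ≤ 2 * m * Real.pi := by positivity
  have he : ∀ᶠ e : ℝ in 𝓝[≥] 0, e ∈ Ico (0 : ℝ) 1 := Ico_mem_nhdsGE one_pos
  have htide := (integral_sub_mul_isBigO_iff hT .param (hl.tide.mul hx0')
    (.of_forall fun _ => continuous_const) (by
      filter_upwards [hx, he] with e hxe he
      exact (hxe.continuous_tide he).mul hx0.continuous_deriv)).2 (by
    simpa only [intervalIntegral.integral_const_mul, mul_zero,
      hx0.integral_tide_mul_deriv_eq_zero hper0 hP hcos] using Asymptotics.isBigO_zero _ _)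
  refine ((integral_sub_mul_isBigO_iff hT hl.stiffness (hx0'.mul hl') ?_ ?_).1
    ((htide.const_mul_left (3 / 4)).congr' ?_ .rfl)).congr_left fun e => by simp only [sq]
  · filter_upwards [hx, he] with e hxe he using hxe.continuous_stiffness he
  · exact hx.mono fun e hxe => hx0.continuous_deriv.mul hxe.continuous_deriv
  · filter_upwards [hx, hxm, he] with e hxe hxme he
    have hxT := (hxe.periodic he hxme) 0
    have hyT := hper0 0
    rw [zero_add] at hxT hyT
    exact (hxe.integral_stiffness_sub_mul he hx0 (hxT.trans hxe.init_pos)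
      (hyT.trans hx0.init_pos)).symm

end Family

namespace IsOddFamily

variable {m p : ℕ} {ε : ℝ} {E : ℝ → ℝ} {φ : ℝ → ℝ → ℝ}

theorem isBigO_velocity_sub (H : IsOddFamily m p ε E φ) :
    (fun e => E e - E 0) =O[𝓝[≥] 0] fun e => e := by
  have hE : DifferentiableWithinAt ℝ E (Ico 0 ε) 0 :=
    H.smooth.differentiableOn (by simp) 0 (left_mem_Ico.2 H.eps_pos)
  rw [← nhdsWithin_Ico_eq_nhdsGE H.eps_pos]
  have h := hE.hasDerivWithinAt.isBigO_sub
  rw [Filter.prod_pure, Asymptotics.isBigO_map] at h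
  simpa only [comp_def, sub_zero] using h

theorem isBigO_trace_sub_two (H : IsOddFamily m p ε E φ) {τ : ℝ → ℝ} (hτ : IsTraceAlong m ε φ τ)
    (hcos : Real.cos (m * Real.pi / p) ≠ 1) :
    (fun e => τ e - 2) =O[𝓝[≥] 0] fun e => e ^ 2 := by
  have hε : ∀ᶠ e in 𝓝[≥] 0, e ∈ Ico 0 ε := Ico_mem_nhdsGE H.eps_pos
  have hx : ∀ᶠ e in 𝓝[≥] 0, IsSitnikovSolution e (E e) (φ · e) := hε.mono H.solution
  have hxm : ∀ᶠ e in 𝓝[≥] 0, φ (m * Real.pi) e = 0 := hε.mono H.boundary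
  have hx0 := hx.self_of_nhdsWithin (mem_Ici.2 le_rfl)
  have hper0 := hx0.periodic zero_mem_Ico_one (hxm.self_of_nhdsWithin (mem_Ici.2 le_rfl))
  have hP := hx0.antiperiodic (P := m * Real.pi / p) (by
    convert H.minimal_period using 1
    ring)
  choose! ψ₁ ψ₂ hψ₁ hψ₂ hτ using hτ
  have hq {e : ℝ} (h : e ∈ Ico 0 ε) : potential φ e = fun t => stiffness (φ t e) (r t e) :=
    funext (potential_eq ⟨h.1, h.2.trans_le H.eps_le_one⟩ φ)
  have hψ₁0 : IsHillSolution (fun t => stiffness (φ t 0) (1 / 2)) 1 0 (ψ₁ 0) := by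
    simpa only [hq (left_mem_Ico.2 H.eps_pos), r_zero_right] using hψ₁ 0 (left_mem_Ico.2 H.eps_pos)
  have hψ₁per := hx0.periodic_of_isHillSolution H.velocity_pos.ne' hper0 hψ₁0
  refine (Sitnikov.isBigO_trace_sub_two (T := 2 * m * Real.pi) (C := 2 * (1 / 4 : ℝ)⁻¹ ^ 3)
    (by positivity) (lipAtZero_of_isSitnikovSolution hx H.isBigO_velocity_sub).1.stiffness ?_ ?_
    (hε.mono fun e h => hq h ▸ hψ₁ e h) (hε.mono fun e h => hq h ▸ hψ₂ e h)
    (hψ₁per.eq.trans hψ₁0.init_pos) ((periodic_deriv hψ₁per).eq.trans hψ₁0.init_vel)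
    ?_).congr' ?_ .rfl
  · filter_upwards [hx, Ico_mem_nhdsGE one_pos] with e hxe he using hxe.continuous_stiffness he
  · filter_upwards [eventually_mem_Icc_half] with e he t
    have := one_fourth_le_r he t
    exact (abs_stiffness_le (r_pos (mem_Ico_one_of_mem_Icc_half he) t)).trans (by gcongr)
  · have hvar := isBigO_integral_stiffness_sub hx H.isBigO_velocity_sub hxm hP hcos
    simp_rw [hx0.deriv_eq_mul hψ₁0, mul_pow, mul_left_comm _ (E 0 ^ 2),
      intervalIntegral.integral_const_mul] at hvar
    exact (Asymptotics.isBigO_const_mul_left_iff (pow_ne_zero 2 H.velocity_pos.ne')).1 hvar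
  · exact hε.mono fun e h => congrArg (· - 2) (hτ e h).symm

end IsOddFamily

theorem hasDerivWithinAt_of_isBigO_sq {τ : ℝ → ℝ} {a : ℝ}
    (h : (fun e => τ e - a) =O[𝓝[≥] 0] fun e => e ^ 2) : HasDerivWithinAt τ 0 (Ici 0) 0 := by
  have h0 : τ 0 = a := by
    obtain ⟨C, hC⟩ := h.bound
    simpa [sub_eq_zero] using hC.self_of_nhdsWithin (mem_Ici.2 le_rfl)
  rw [hasDerivWithinAt_iff_isLittleO, h0]
  simpa only [sub_zero, smul_zero] using
    h.trans_isLittleO ((Asymptotics.isLittleO_pow_id one_lt_two).mono nhdsWithin_le_nhds)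

theorem cos_nat_mul_pi_div_eq_one_iff {m p : ℕ} (hp : p ≠ 0) :
    Real.cos (m * Real.pi / p) = 1 ↔ 2 * p ∣ m := by
  have hturns (n : ℤ) : n * (2 * Real.pi) = m * Real.pi / p ↔ (m : ℤ) = (2 * p : ℕ) * n := by
    rw [eq_div_iff (by positivity), ← Int.cast_inj (α := ℝ)]
    push_cast
    exact ⟨fun h => mul_right_cancel₀ Real.pi_ne_zero (by linear_combination -h),
      fun h => by linear_combination -Real.pi * h⟩
  rw [Real.cos_eq_one_iff, ← Int.natCast_dvd_natCast]
  exact exists_congr hturns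

theorem traceDerivVanishes_of_not_dvd {m p : ℕ} (hp : p ≠ 0) (h : ¬2 * p ∣ m) :
    TraceDerivVanishes m p :=
  fun _ _ _ _ H hτ => hasDerivWithinAt_of_isBigO_sq
    (H.isBigO_trace_sub_two hτ (mt (cos_nat_mul_pi_div_eq_one_iff hp).1 h))

/-! ### Sturm comparison -/

theorem exists_first_zero {y : ℝ → ℝ} {T : ℝ} (hy : Differentiable ℝ y) (h0 : y 0 = 0)
    (h0' : 0 < deriv y 0) (hT : 0 < T) (hyT : y T ≤ 0) :
    ∃ s ∈ Ioc 0 T, y s = 0 ∧ deriv y s ≤ 0 ∧ ∀ t ∈ Ioo 0 s, 0 < y t := by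
  obtain ⟨δ, hδ, hpos⟩ : ∃ δ > 0, ∀ t ∈ Ioo 0 δ, 0 < y t := by
    have hsign := (eventually_nhdsWithin_sign_eq_of_deriv_pos h0' h0).filter_mono
      (nhdsWithin_le_nhds (s := Ioi 0))
    obtain ⟨δ, hδ, hsign⟩ := mem_nhdsGT_iff_exists_Ioo_subset.1 hsign
    refine ⟨δ, hδ, fun t ht => sign_eq_one_iff.1 ?_⟩
    rw [hsign ht, sub_zero, sign_pos ht.1]
  have hδT : δ / 2 ≤ T := by
    by_contra! h
    exact (hpos T ⟨hT, by linarith [hδ.lt]⟩).not_ge hyT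
  obtain ⟨s, ⟨hs, hys⟩, hmin⟩ := (isCompact_Icc.inter_right
    (isClosed_le hy.continuous continuous_const)).exists_isLeast ⟨T, ⟨hδT, le_rfl⟩, hyT⟩
  have hs0 : 0 < s := (half_pos hδ).trans_le hs.1
  have hpos' : ∀ t ∈ Ioo 0 s, 0 < y t := fun t ht => by
    rcases lt_or_ge t δ with h | h
    · exact hpos t ⟨ht.1, h⟩
    · by_contra! hcon
      exact ht.2.not_ge (hmin ⟨⟨by linarith [hδ.lt], ht.2.le.trans hs.2⟩, hcon⟩)
  have hleft : ∀ᶠ t in 𝓝[<] s, 0 < y t := by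
    filter_upwards [Ioo_mem_nhdsLT hs0] using hpos'
  have hzero : y s = 0 := hys.antisymm
    (ge_of_tendsto hy.continuous.continuousWithinAt (hleft.mono fun _ h => h.le))
  refine ⟨s, ⟨hs0, hs.2⟩, hzero, ?_, hpos'⟩
  by_contra! hderiv
  have hsign := (eventually_nhdsWithin_sign_eq_of_deriv_pos hderiv hzero).filter_mono
    (nhdsWithin_le_nhds (s := Iio s))
  obtain ⟨t, hts, ht, hlt⟩ := (hsign.and (hleft.and self_mem_nhdsWithin)).exists
  rw [sign_pos ht, sign_neg (sub_neg.2 hlt)] at hts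
  exact absurd hts (by decide)

namespace IsHillSolution

variable {q₀ q₁ y z : ℝ → ℝ} {v w s T : ℝ}

theorem deriv_mul_lt (hq₀ : Continuous q₀) (hq₁ : Continuous q₁) (hy : IsHillSolution q₀ 0 v y)
    (hz : IsHillSolution q₁ 0 w z) (hs : 0 < s) (hq : ∀ t ∈ Ioo 0 s, q₀ t < q₁ t)
    (hy0 : ∀ t ∈ Ioo 0 s, 0 < y t) (hz0 : ∀ t ∈ Ioo 0 s, 0 < z t) :
    y s * deriv z s < deriv y s * z s := by
  have hyc := hy.continuous
  have hzc := hz.continuous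
  have hpos : 0 < ∫ t in (0 : ℝ)..s, (q₁ t - q₀ t) * (z t * y t) :=
    intervalIntegral.intervalIntegral_pos_of_pos_on
      (Continuous.intervalIntegrable (by fun_prop) _ _)
      (fun t ht => mul_pos (sub_pos.2 (hq t ht)) (mul_pos (hz0 t ht) (hy0 t ht))) hs
  rw [hz.integral_sub_mul_mul hq₁ hq₀ hy] at hpos
  linarith

theorem pos_of_sturm (hq₀ : Continuous q₀) (hq₁ : Continuous q₁) (hy : IsHillSolution q₀ 0 v y)
    (hz : IsHillSolution q₁ 0 w z) (hv : 0 < v) (hq : ∀ t ∈ Ioo 0 T, q₀ t < q₁ t)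
    (hz0 : ∀ t ∈ Ioo 0 T, 0 < z t) (hT : 0 < T) : 0 < y T := by
  by_contra! hyT
  obtain ⟨s, hs, hys, hys', hpos⟩ :=
    exists_first_zero hy.differentiable hy.init_pos (hy.init_vel.symm ▸ hv) hT hyT
  have hsub : Ioo 0 s ⊆ Ioo 0 T := Ioo_subset_Ioo_right hs.2
  have hzs : 0 ≤ z s := by
    refine ge_of_tendsto (hz.continuous.continuousWithinAt (s := Iio s)) ?_
    filter_upwards [Ioo_mem_nhdsLT hs.1] with t ht using (hz0 t (hsub ht)).le
  have hlt := deriv_mul_lt hq₀ hq₁ hy hz hs.1 (fun t ht => hq t (hsub ht)) hpos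
    fun t ht => hz0 t (hsub ht)
  rw [hys, zero_mul] at hlt
  exact hlt.not_ge (mul_nonpos_of_nonpos_of_nonneg hys' hzs)

end IsHillSolution

theorem invDist_le_of_abs_le {x y ρ : ℝ} (hρ : 0 < ρ) (h : |x| ≤ |y|) :
    invDist y ρ ≤ invDist x ρ := by
  have := sq_le_sq.2 h
  unfold invDist
  gcongr

theorem isHillSolution_sin (a : ℝ) :
    IsHillSolution (fun _ => a ^ 2) 0 a fun t => Real.sin (a * t) := by
  have hlin t : HasDerivAt (fun t : ℝ => a * t) a t := by
    simpa only [mul_one] using (hasDerivAt_id' t).const_mul a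
  have h := IsSolutionIVP.of_hasDerivAt (g := fun y _ => a ^ 2 * y) (fun t => (hlin t).sin)
    fun t => ((hlin t).cos.mul_const a).congr_deriv (by ring)
  simpa only [mul_zero, Real.sin_zero, Real.cos_zero, one_mul] using h

/-! ### Periodic solutions of the circular problem -/

namespace IsSitnikovSolution

variable {η σ : ℝ} {x : ℝ → ℝ}

theorem isHillSolution (hx : IsSitnikovSolution 0 η x) :
    IsHillSolution (fun t => invDist (x t) (1 / 2) ^ 3) 0 η x where
  differentiable := hx.differentiable
  equation t := (hx.equation t).congr_deriv (by rw [F_zero_right, force, mul_comm])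
  init_pos := hx.init_pos
  init_vel := hx.init_vel

theorem abs_apply_le (hx : IsSitnikovSolution 0 η x) (t : ℝ) : |x t| ≤ |η| * |t| := by
  have hbound s : ‖deriv x s‖ ≤ |η| := sq_le_sq.1 <| by
    linarith [hx.energy s, invDist_le_inv (x := x s) one_half_pos]
  simpa only [Real.norm_eq_abs, hx.init_pos, sub_zero] using
    convex_univ.norm_image_sub_le_of_norm_deriv_le (fun s _ => hx.differentiable s)
      (fun s _ => hbound s) (mem_univ 0) (mem_univ t)

theorem deriv_pos_of_nonneg (hx : IsSitnikovSolution 0 η x) (hη : 0 < η)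
    (h : ∀ t ∈ Icc 0 σ, 0 ≤ deriv x t) : ∀ t ∈ Ico 0 σ, 0 < deriv x t := by
  intro t ht
  rcases ht.1.eq_or_lt with rfl | ht0
  · exact hx.init_vel.symm ▸ hη
  refine (h t (Ico_subset_Icc_self ht)).lt_of_ne fun hzero => hη.ne' ?_
  -- an interior zero of `x' ≥ 0` is a minimum of `x'`, so the force and hence `x` vanish there
  have hmin : IsLocalMin (deriv x) t := by
    filter_upwards [Icc_mem_nhds ht0 ht.2] with s hs using hzero ▸ h s hs
  have hxt : x t = 0 := by
    have hF := hmin.hasDerivAt_eq_zero (hx.equation t)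
    rw [F_zero_right, force, neg_eq_zero, mul_eq_zero] at hF
    exact hF.resolve_right (pow_pos (invDist_pos one_half_pos) 3).ne'
  have h₀ := hx.energy 0
  rw [← hx.energy t, hx.init_pos, hx.init_vel, hxt, ← hzero] at h₀
  exact pow_eq_zero_iff two_ne_zero |>.1 (by linarith)

theorem pos_of_deriv_pos (hx : IsSitnikovSolution 0 η x) (h : ∀ t ∈ Ico 0 σ, 0 < deriv x t) :
    ∀ t ∈ Ioc 0 σ, 0 < x t := by
  intro t ht
  have hmono : StrictMonoOn x (Icc 0 σ) := strictMonoOn_of_deriv_pos (convex_Icc 0 σ)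
    hx.continuous.continuousOn fun s hs => by
      rw [interior_Icc] at hs
      exact h s (Ioo_subset_Ico_self hs)
  simpa only [hx.init_pos] using
    hmono (left_mem_Icc.2 (ht.1.le.trans ht.2)) (Ioc_subset_Icc_self ht) ht.1

theorem deriv_pos_of_escape (hx : IsSitnikovSolution 0 2 x) {t : ℝ} (ht : 0 ≤ t) :
    0 < deriv x t := by
  by_contra! hle
  obtain ⟨s, -, hs⟩ := intermediate_value_Icc' ht hx.continuous_deriv.continuousOn
    (show (0 : ℝ) ∈ Icc (deriv x t) (deriv x 0) from ⟨hle, hx.init_vel.symm ▸ two_pos.le⟩)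
  have henergy := hx.energy s
  rw [hs] at henergy
  linarith [invDist_pos (x := x s) one_half_pos]

theorem exists_deriv_neg (hx : IsSitnikovSolution 0 η x) (hη : 0 < η) (hσ : 0 < σ)
    (hslow : (Real.pi / (2 * σ)) ^ 2 < invDist (η * σ) (1 / 2) ^ 3) :
    ∃ t ∈ Icc 0 σ, deriv x t < 0 := by
  by_contra! hnonneg
  set a := Real.pi / (2 * σ) with ha
  have ha0 : 0 < a := by positivity
  have haσ : a * σ = Real.pi / 2 := by rw [ha]; field_simp
  have hxpos := hx.pos_of_deriv_pos (hx.deriv_pos_of_nonneg hη hnonneg)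
  have hcompare := (isHillSolution_sin a).deriv_mul_lt continuous_const
    ((continuous_invDist hx.continuous continuous_const fun _ => one_half_pos).pow 3)
    hx.isHillSolution hσ (fun t ht => ?_) (fun t ht => ?_)
    fun t ht => hxpos t (Ioo_subset_Ioc_self ht)
  · rw [deriv_comp_mul_left a Real.sin, Real.deriv_sin, haσ, Real.sin_pi_div_two,
      Real.cos_pi_div_two, smul_zero, zero_mul, one_mul] at hcompare
    exact hcompare.not_ge (hnonneg σ (right_mem_Icc.2 hσ.le))
  · have hle : |x t| ≤ |η * σ| := (hx.abs_apply_le t).trans <| by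
      rw [abs_mul, abs_of_pos ht.1, abs_of_pos hσ]
      exact mul_le_mul_of_nonneg_left ht.2.le (abs_nonneg η)
    refine hslow.trans_le (pow_le_pow_left₀ (invDist_pos one_half_pos).le ?_ 3)
    exact invDist_le_of_abs_le one_half_pos hle
  · refine Real.sin_pos_of_pos_of_lt_pi (mul_pos ha0 ht.1) ?_
    calc a * t < a * σ := by gcongr; exact ht.2
      _ < Real.pi := by linarith [Real.pi_pos]

end IsSitnikovSolution

-- The bound on `σ` is `σ > π / (2√8)`, the quarter period of the linearization at the origin.
theorem exists_velocity_turning_before {σ : ℝ} (hσ : (Real.pi / (2 * σ)) ^ 2 < 8) :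
    ∃ η ∈ Ioc (0 : ℝ) 2, (Real.pi / (2 * σ)) ^ 2 < invDist (η * σ) (1 / 2) ^ 3 := by
  have hcont : Continuous fun η : ℝ => invDist (η * σ) (1 / 2) ^ 3 :=
    (continuous_invDist (by fun_prop) continuous_const fun _ => one_half_pos).pow 3
  have h0 : (Real.pi / (2 * σ)) ^ 2 < invDist (0 * σ) (1 / 2) ^ 3 := by
    rw [zero_mul, invDist_eq_of_sq_mul (w := 2) two_pos (by norm_num)]
    linarith
  have hslow : ∀ᶠ η in 𝓝[>] 0, (Real.pi / (2 * σ)) ^ 2 < invDist (η * σ) (1 / 2) ^ 3 :=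
    nhdsWithin_le_nhds (hcont.continuousAt.eventually_const_lt h0)
  obtain ⟨η, hslow, hη⟩ := (hslow.and (Ioc_mem_nhdsGT two_pos)).exists
  exact ⟨η, hη, hslow⟩

theorem exists_min_eq_zero {f : ℝ → ℝ → ℝ} {K : ℝ≥0} {a b c d : ℝ} (hab : a ≤ b) (hcd : c ≤ d)
    (hf : ∀ η, ContinuousOn (f η) (Icc c d)) (hK : ∀ t ∈ Icc c d, LipschitzWith K (f · t))
    (ha : ∃ t ∈ Icc c d, f a t ≤ 0) (hb : ∀ t ∈ Icc c d, 0 ≤ f b t) :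
    ∃ η ∈ Icc a b, (∀ t ∈ Icc c d, 0 ≤ f η t) ∧ ∃ t ∈ Icc c d, f η t = 0 := by
  choose τ hτ hmin using fun η => isCompact_Icc.exists_isMinOn (nonempty_Icc.2 hcd) (hf η)
  simp only [isMinOn_iff] at hmin
  have hlip : LipschitzWith K fun η => f η (τ η) := .of_le_add_mul K fun η ζ =>
    (hmin η _ (hτ ζ)).trans ((hK _ (hτ ζ)).le_add_mul η ζ)
  obtain ⟨t, ht, hat⟩ := ha
  obtain ⟨η, hη, hzero⟩ := intermediate_value_Icc hab hlip.continuous.continuousOn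
    ⟨(hmin a t ht).trans hat, hb _ (hτ b)⟩
  exact ⟨η, hη, fun t ht => hzero.symm.trans_le (hmin η t ht), τ η, hτ η, hzero⟩

theorem exists_turning_at {σ : ℝ} (hσ : 0 < σ) (hσ8 : (Real.pi / (2 * σ)) ^ 2 < 8) :
    ∃ η x, 0 < η ∧ IsSitnikovSolution 0 η x ∧ deriv x σ = 0 ∧
      ∀ t ∈ Ico 0 σ, 0 < deriv x t := by
  choose X hX using exists_isSitnikovSolution zero_mem_Ico_one
  obtain ⟨η₀, hη₀, hslow⟩ := exists_velocity_turning_before hσ8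
  obtain ⟨s, hs, hneg⟩ := (hX η₀).exists_deriv_neg hη₀.1 hσ hslow
  obtain ⟨η, hη, hnonneg, t, ht, hzero⟩ := exists_min_eq_zero (f := fun η => deriv (X η))
    hη₀.2 hσ.le
    (fun η => (hX η).continuous_deriv.continuousOn)
    (fun t ht => .of_dist_le' fun η ζ => by
      have hdiff := ((hX η).abs_sub_le (lipschitzWith_F zero_mem_Ico_one) (hX ζ) le_rfl
        (fun t _ => by rw [sub_self, abs_zero]) (by rw [sub_self, abs_zero]; positivity)
        le_rfl ht).2
      rwa [add_zero, mul_comm] at hdiff)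
    ⟨s, hs, hneg.le⟩ fun t ht => ((hX 2).deriv_pos_of_escape ht.1).le
  have hη0 : 0 < η := hη₀.1.trans_le hη.1
  have hpos := (hX η).deriv_pos_of_nonneg hη0 hnonneg
  have htσ : t = σ := ht.2.eq_of_not_lt fun hlt => (hpos t ⟨ht.1, hlt⟩).ne' hzero
  exact ⟨η, X η, hη0, hX η, htσ ▸ hzero, hpos⟩

theorem exists_antiperiodic_pos {S : ℝ} (hS : 0 < S) (hS8 : Real.pi ^ 2 < 8 * S ^ 2) :
    ∃ η x, 0 < η ∧ IsSitnikovSolution 0 η x ∧ Antiperiodic x S ∧ ∀ t ∈ Ioo 0 S, 0 < x t := by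
  obtain ⟨η, x, hη, hx, hturn, hpos⟩ := exists_turning_at (half_pos hS) (by
    rw [mul_div_cancel₀ _ two_ne_zero, div_pow, div_lt_iff₀ (by positivity)]
    exact hS8)
  have hsymm := hx.eq_comp_const_sub (lipschitzWith_F zero_mem_Ico_one)
    (fun y t => by rw [F_zero_right, F_zero_right]) hturn
  rw [mul_div_cancel₀ _ two_ne_zero] at hsymm
  refine ⟨η, x, hη, hx, fun t => ?_, fun t ht => ?_⟩
  · rw [← hx.neg_apply zero_mem_Ico_one, ← hsymm (-t), sub_neg_eq_add, add_comm]
  · rcases le_total t (S / 2) with hle | hle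
    · exact hx.pos_of_deriv_pos hpos t ⟨ht.1, hle⟩
    · rw [← hsymm]
      exact hx.pos_of_deriv_pos hpos _ ⟨by linarith [ht.2], by linarith⟩

namespace IsSitnikovSolution

variable {η S : ℝ} {x : ℝ → ℝ}

theorem isMinimalPeriod (hx : IsSitnikovSolution 0 η x) (hη : 0 < η) (hS0 : 0 < S)
    (hS : Antiperiodic x S) (hpos : ∀ t ∈ Ioo 0 S, 0 < x t) : IsMinimalPeriod x (2 * S) := by
  refine ⟨⟨by linarith, hS.periodic_two_mul⟩, fun s ⟨hs0, hs⟩ => ?_⟩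
  by_contra! hlt
  have hxs : x s = 0 := by rw [hs.eq, hx.init_pos]
  rcases lt_trichotomy s S with h | rfl | h
  · exact (hpos s ⟨hs0, h⟩).ne' hxs
  · have h0 := antiperiodic_deriv hS 0
    rw [periodic_deriv hs, hx.init_vel] at h0
    linarith
  · have hxS := hS (s - S)
    rw [sub_add_cancel, hxs] at hxS
    linarith [hpos (s - S) ⟨by linarith, by linarith⟩]

theorem hillSolution_shift (hx : IsSitnikovSolution 0 η x) (hη : η ≠ 0) (hS : Antiperiodic x S)
    {ψ : ℝ → ℝ} (hψ : IsHillSolution (fun t => stiffness (x t) (1 / 2)) 0 1 ψ) (t : ℝ) :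
    ψ (t + S) = -ψ t + ψ S / η * deriv x t := by
  have hv := hx.deriv_isHillSolution
  have hvS : deriv x S = -η := by rw [(antiperiodic_deriv hS).eq, hx.init_vel]
  have hvS' : deriv (deriv x) S = 0 := by
    rw [(antiperiodic_deriv (antiperiodic_deriv hS)).eq, hv.init_vel, neg_zero]
  have hqc := Sitnikov.continuous_stiffness hx.continuous continuous_const fun _ => one_half_pos
  have hdet : deriv ψ S = -1 := by
    have h := hv.integral_sub_mul_mul hqc hqc hψ S
    simp only [sub_self, zero_mul, intervalIntegral.integral_zero, hvS, hvS'] at h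
    exact mul_left_cancel₀ hη (by linarith)
  have hshift := hψ.comp_add_const S
  simp only [hS _, stiffness, invDist_neg, neg_sq] at hshift
  have hcomb := hψ.linear_comb hv (-1) (ψ S / η)
  have heq := IsHillSolution.ext_of_eq_at (fun t => abs_stiffness_le one_half_pos) hshift hcomb
    (c := 0) (by rw [hshift.init_pos, hcomb.init_pos]; field_simp; ring)
    (by rw [hshift.init_vel, hcomb.init_vel, hdet]; ring)
  simpa only [neg_one_mul] using congrFun heq t

theorem hillSolution_pos (hx : IsSitnikovSolution 0 η x) (hS0 : 0 < S)
    (hpos : ∀ t ∈ Ioo 0 S, 0 < x t) {ψ : ℝ → ℝ}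
    (hψ : IsHillSolution (fun t => stiffness (x t) (1 / 2)) 0 1 ψ) : 0 < ψ S := by
  refine hψ.pos_of_sturm
    (Sitnikov.continuous_stiffness hx.continuous continuous_const fun _ => one_half_pos)
    ((continuous_invDist hx.continuous continuous_const fun _ => one_half_pos).pow 3)
    hx.isHillSolution one_pos (fun t ht => ?_) hpos hS0
  have := hpos t ht
  have := invDist_pos (x := x t) one_half_pos
  exact sub_lt_self _ (by positivity)

theorem hillSolution_ne_zero (hx : IsSitnikovSolution 0 η x) (hη : η ≠ 0) (hS0 : 0 < S)
    (hS : Antiperiodic x S) (hpos : ∀ t ∈ Ioo 0 S, 0 < x t) {ψ : ℝ → ℝ}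
    (hψ : IsHillSolution (fun t => stiffness (x t) (1 / 2)) 0 1 ψ) {k : ℕ} (hk : k ≠ 0) :
    ψ (k * S) ≠ 0 := by
  set c := ψ S / η with hc
  have hc0 : c ≠ 0 := div_ne_zero (hx.hillSolution_pos hS0 hpos hψ).ne' hη
  -- the Floquet normal form of `ψ`: an antiperiodic function plus a secular term
  have hfloquet : Antiperiodic (fun t => ψ t + t / S * c * deriv x t) S := fun t => by
    simp only [hx.hillSolution_shift hη hS hψ t, antiperiodic_deriv hS t, ← hc]
    field_simp
    ring
  have hψk := hfloquet.add_nat_mul_eq k (x := 0)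
  have hvk := (antiperiodic_deriv hS).add_nat_mul_eq k (x := 0)
  simp only [zero_add, hψ.init_pos, zero_div, zero_mul, add_zero, mul_zero, hx.init_vel] at hψk hvk
  rw [mul_div_cancel_right₀ _ hS0.ne', hvk] at hψk
  rw [eq_neg_of_add_eq_zero_left hψk, neg_ne_zero]
  exact mul_ne_zero (mul_ne_zero (Nat.cast_ne_zero.2 hk) hc0)
    (mul_ne_zero (pow_ne_zero k (by norm_num)) hη)

end IsSitnikovSolution

/-! ### Continuation to small eccentricities -/

section Trajectory

variable {e η L : ℝ}

/-- The solution of `x'' + f(u(t, e)) = 0`, `x(0) = 0`, `x'(0) = η` as a function of the eccentric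
anomaly `u`. This independent variable makes the problem polynomial in `e`, as `dt/du` is
`1 - e cos u`. -/
def trajectory (f : ℝ → ℝ) (e η u : ℝ) : ℝ :=
  ∫ s in (0 : ℝ)..u, (1 - e * Real.cos s) * (η - ∫ σ in (0 : ℝ)..s, (1 - e * Real.cos σ) * f σ)

theorem isSolutionIVP_trajectory {f : ℝ → ℝ} (hf : Continuous f) (he : e ∈ Ico (0 : ℝ) 1) (η : ℝ) :
    IsSolutionIVP (fun _ t => f (kepler t e)) 0 η fun t => trajectory f e η (kepler t e) := by
  have hcont : Continuous fun σ => (1 - e * Real.cos σ) * f σ := by fun_prop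
  have hvel s : HasDerivAt (fun s => η - ∫ σ in (0 : ℝ)..s, (1 - e * Real.cos σ) * f σ)
      (-((1 - e * Real.cos s) * f s)) s :=
    (hcont.integral_hasStrictDerivAt 0 s).hasDerivAt.const_sub η
  have := Differentiable.continuous (𝕜 := ℝ) fun s => (hvel s).differentiableAt
  have hpos u : HasDerivAt (trajectory f e η)
      ((1 - e * Real.cos u) * (η - ∫ σ in (0 : ℝ)..u, (1 - e * Real.cos σ) * f σ)) u :=
    (Continuous.integral_hasStrictDerivAt (by fun_prop) 0 u).hasDerivAt
  have hweight t := (one_sub_mul_cos_pos he (kepler t e)).ne'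
  have hsol := IsSolutionIVP.of_hasDerivAt (g := fun _ t => f (kepler t e))
    (fun t => HasDerivAt.congr_deriv ((hpos _).comp t (hasDerivAt_kepler he t))
      (by rw [mul_right_comm, mul_inv_cancel₀ (hweight t), one_mul]; rfl))
    fun t => ((hvel _).comp t (hasDerivAt_kepler he t)).congr_deriv
      (by rw [neg_mul, mul_right_comm, mul_inv_cancel₀ (hweight t), one_mul])
  have hk : kepler 0 e = 0 := (kepler_eq_iff he).2 (by simp)
  have hinit : trajectory f e η 0 = 0 := intervalIntegral.integral_same
  simpa only [comp_def, hk, hinit, intervalIntegral.integral_same, sub_zero] using hsol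

theorem kepler_mem_Icc_iff (he : e ∈ Ico (0 : ℝ) 1) (hk : kepler L e = L) {t : ℝ} :
    kepler t e ∈ Icc 0 L ↔ t ∈ Icc 0 L := by
  have hmono := kepler_strictMono he.1 he.2
  rw [mem_Icc, mem_Icc, ← hmono.le_iff_le, ← hmono.le_iff_le (a := kepler t e)]
  simp only [kepler_spec he.1 he.2, (kepler_eq_iff he).1 hk, Real.sin_zero, mul_zero, sub_zero]

end Trajectory

/-- The continuous functions on `[0, L]`, with the supremum norm. -/
abbrev Curve (L : ℝ) := C(Icc (0 : ℝ) L, ℝ)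

section Curve

variable {L : ℝ} (hL : 0 ≤ L)

/-- The primitive that vanishes at `0`. -/
def primitive : Curve L →L[ℝ] Curve L :=
  LinearMap.mkContinuous
    { toFun f := ⟨fun t => ∫ s in (0 : ℝ)..t, IccExtend hL f s,
        (intervalIntegral.continuous_primitive
          (fun _ _ => f.continuous.Icc_extend'.intervalIntegrable _ _) 0).comp
          continuous_subtype_val⟩
      map_add' f g := by
        ext t
        exact intervalIntegral.integral_add (f.continuous.Icc_extend'.intervalIntegrable _ _)
          (g.continuous.Icc_extend'.intervalIntegrable _ _)
      map_smul' c f := by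
        ext t
        exact intervalIntegral.integral_const_mul c _ } L
    fun f => by
      refine (ContinuousMap.norm_le _ (by positivity)).2 fun t => ?_
      refine (intervalIntegral.norm_integral_le_of_norm_le_const
        fun s _ => f.norm_coe_le_norm (projIcc 0 L hL s)).trans ?_
      rw [sub_zero, abs_of_nonneg t.2.1, mul_comm]
      exact mul_le_mul_of_nonneg_right t.2.2 (norm_nonneg f)

theorem primitive_apply_eq {f : Curve L} {g : ℝ → ℝ} (h : ∀ s : Icc (0 : ℝ) L, f s = g s)
    (t : Icc (0 : ℝ) L) : primitive hL f t = ∫ s in (0 : ℝ)..t, g s := by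
  refine intervalIntegral.integral_congr fun s hs => ?_
  rw [uIcc_of_le t.2.1] at hs
  rw [IccExtend_of_mem hL f ⟨hs.1, hs.2.trans t.2.2⟩, h]

/-- The function `1 - e cos u` of the eccentric anomaly: the derivative of time, and twice the
value of `r`. -/
def weight (L e : ℝ) : Curve L := 1 - e • ⟨fun u => Real.cos u, by fun_prop⟩

theorem weight_zero : weight L 0 = 1 := by
  rw [weight, zero_smul, sub_zero]

/-- `trajectory` as a polynomial map between spaces of continuous functions. -/
def response (e η : ℝ) (f : Curve L) : Curve L :=
  primitive hL (weight L e * (η • (1 : Curve L) - primitive hL (weight L e * f)))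

theorem response_apply (e η : ℝ) (f : Curve L) (u : Icc (0 : ℝ) L) :
    response hL e η f u = trajectory (IccExtend hL f) e η u := by
  have hinner s := primitive_apply_eq hL (f := weight L e * f)
    (g := fun σ => (1 - e * Real.cos σ) * IccExtend hL f σ)
    (fun s => by rw [ContinuousMap.mul_apply, IccExtend_val]; rfl) s
  refine primitive_apply_eq hL (fun s => ?_) u
  rw [ContinuousMap.mul_apply, ContinuousMap.sub_apply, hinner]
  exact congrArg (fun c => (1 - e * Real.cos s) * (c - _)) (mul_one η)

theorem eq_response_iff {e η : ℝ} {g : ℝ → ℝ → ℝ} {K : ℝ≥0} {X : ℝ → ℝ} {y f : Curve L}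
    (he : e ∈ Ico (0 : ℝ) 1) (hk : kepler L e = L) (hg : ∀ t, LipschitzWith K (g · t))
    (hX : IsSolutionIVP g 0 η X) (hf : ∀ t ∈ Icc 0 L,
      g (IccExtend hL y (kepler t e)) t = IccExtend hL f (kepler t e)) :
    y = response hL e η f ↔ ∀ t ∈ Icc 0 L, IccExtend hL y (kepler t e) = X t := by
  have hY := isSolutionIVP_trajectory (f.continuous.Icc_extend' (h := hL)) he η
  have hYapply t (ht : t ∈ Icc 0 L) : IccExtend hL (response hL e η f) (kepler t e) =
      trajectory (IccExtend hL f) e η (kepler t e) := by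
    rw [IccExtend_of_mem hL _ ((kepler_mem_Icc_iff he hk).2 ht), response_apply]
  refine ⟨?_, fun hyX => ContinuousMap.ext fun u => ?_⟩
  · rintro rfl t ht
    have hdiff := (hX.abs_sub_le hg hY le_rfl
      (fun t ht => by rw [← hYapply t ht, hf t ht, sub_self, abs_zero])
      (by rw [sub_self, abs_zero]) (by rw [sub_self, abs_zero]) ht).1
    rw [add_zero, zero_mul, abs_nonpos_iff, sub_eq_zero] at hdiff
    rw [hYapply t ht, hdiff]
  · set t := (u : ℝ) - e * Real.sin u
    have htu : kepler t e = u := (kepler_eq_iff he).2 rfl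
    have ht : t ∈ Icc 0 L := (kepler_mem_Icc_iff he hk).1 (htu ▸ u.2)
    have hdiff := (hY.abs_sub_le (fun t => .const (IccExtend hL f (kepler t e))) hX le_rfl
      (fun t ht => by rw [← hf t ht, hyX t ht, sub_self, abs_zero])
      (by rw [sub_self, abs_zero]) (by rw [sub_self, abs_zero]) ht).1
    rw [add_zero, zero_mul, abs_nonpos_iff, sub_eq_zero] at hdiff
    rw [← IccExtend_val hL y, ← htu, hyX t ht, ← hdiff, ← hYapply t ht, htu, IccExtend_val]

theorem eq_response_zero_iff {η : ℝ} {g : ℝ → ℝ → ℝ} {K : ℝ≥0} {X : ℝ → ℝ} {y f : Curve L}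
    (hg : ∀ t, LipschitzWith K (g · t)) (hX : IsSolutionIVP g 0 η X)
    (hf : ∀ t : Icc (0 : ℝ) L, g (y t) t = f t) :
    y = response hL 0 η f ↔ ∀ t : Icc (0 : ℝ) L, y t = X t := by
  rw [eq_response_iff hL zero_mem_Ico_one (kepler_zero_right L) hg hX fun t ht => (by
    rw [kepler_zero_right, IccExtend_of_mem hL _ ht, IccExtend_of_mem hL _ ht, hf ⟨t, ht⟩])]
  simp only [kepler_zero_right, Subtype.forall]
  exact forall₂_congr fun t ht => by rw [IccExtend_of_mem hL _ ht]

theorem existsUnique_linear_bvp {q ψ : ℝ → ℝ} {C : ℝ} (hq : Continuous q) (hC : ∀ t, |q t| ≤ C)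
    (hψ : IsHillSolution q 0 1 ψ) (hne : ψ L ≠ 0) {k : Curve L}
    (hk : ∀ t : Icc (0 : ℝ) L, k t = q t) (f g : Curve L) (c : ℝ) :
    ∃! p : Curve L × ℝ, p.1 - response hL 0 p.2 (k * p.1 + g) = f ∧ p.1 ⟨L, hL, le_rfl⟩ = c := by
  set h : Curve L := k * f + g
  obtain ⟨z, hz⟩ := exists_isLinearSolution hq hC h.continuous.Icc_extend'
    (fun t => h.norm_coe_le_norm (projIcc 0 L hL t)) 0 0
  have hshoot β : IsLinearSolution q (IccExtend hL h) 0 β fun t => z t + β * ψ t := by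
    have := IsSolutionIVP.of_hasDerivAt (g := fun y t => q t * y + IccExtend hL h t)
      (fun t => (hz.hasDerivAt t).fun_add ((hψ.hasDerivAt t).const_mul β))
      fun t => ((hz.equation t).fun_add ((hψ.equation t).const_mul β)).congr_deriv (by ring)
    simpa only [hz.init_pos, hz.init_vel, hψ.init_pos, hψ.init_vel, mul_zero, mul_one, zero_add]
      using this
  have hiff (a : Curve L) (β : ℝ) : a - response hL 0 β (k * a + g) = f ↔
      ∀ t : Icc (0 : ℝ) L, a t - f t = z t + β * ψ t := by
    rw [sub_eq_iff_eq_add, ← sub_eq_iff_eq_add', eq_response_zero_iff hL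
      (fun t => lipschitzWith_const_mul_add (hC t) _) (hshoot β) fun t => ?_]
    · rfl
    · rw [IccExtend_val]
      simp only [h, ContinuousMap.add_apply, ContinuousMap.mul_apply, ContinuousMap.sub_apply, hk]
      ring
  set β₀ := (c - f ⟨L, hL, le_rfl⟩ - z L) / ψ L with hβ₀
  have hβ₀L : z L + β₀ * ψ L = c - f ⟨L, hL, le_rfl⟩ := by
    rw [hβ₀, div_mul_cancel₀ _ hne, add_sub_cancel]
  refine ⟨(f + ⟨fun t => z t + β₀ * ψ t, (hshoot β₀).continuous.comp continuous_subtype_val⟩, β₀),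
    ⟨(hiff _ _).2 fun t => add_sub_cancel_left _ _, ?_⟩, ?_⟩
  · exact (congrArg (f ⟨L, hL, le_rfl⟩ + ·) hβ₀L).trans (add_sub_cancel _ _)
  · rintro ⟨a, β⟩ ⟨ha, haL⟩
    have ha' := (hiff a β).1 ha
    have hβ : β = β₀ := by
      rw [hβ₀, eq_div_iff hne, ← haL, ha' ⟨L, hL, le_rfl⟩, add_sub_cancel_left]
    refine Prod.ext (ContinuousMap.ext fun t => ?_) hβ
    exact (sub_eq_iff_eq_add'.1 (ha' t)).trans (by rw [hβ]; rfl)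

/-- The boundary value problem for odd periodic solutions, with the parameter `e` and the unknowns
`y` (position), `w` (inverse distance to the primaries) and `η` (initial velocity). Treating `w` as
an unknown of its own makes it polynomial. -/
def bvp (p : ℝ × Curve L × Curve L × ℝ) : Curve L × Curve L × ℝ :=
  (p.2.1 - response hL p.1 p.2.2.2 (p.2.1 * p.2.2.1 ^ 3),
    p.2.2.1 ^ 2 * (p.2.1 ^ 2 + (1 / 4 : ℝ) • weight L p.1 ^ 2) - 1,
    ContinuousMap.evalCLM ℝ (⟨L, hL, le_rfl⟩ : Icc (0 : ℝ) L) p.2.1)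

theorem contDiff_bvp : ContDiff ℝ ω (bvp hL) := by
  unfold bvp response weight
  fun_prop

theorem bvp_eq_zero_iff {e η : ℝ} {y w : Curve L} {X : ℝ → ℝ} (he : e ∈ Ico (0 : ℝ) 1)
    (hk : kepler L e = L) (hX : IsSitnikovSolution e η X) (hw : ∀ u, 0 < w u) :
    bvp hL (e, y, w, η) = 0 ↔ (∀ u, invDist (y u) (weight L e u / 2) = w u) ∧
      (∀ t ∈ Icc 0 L, IccExtend hL y (kepler t e) = X t) ∧ X L = 0 := by
  have hdist : w ^ 2 * (y ^ 2 + (1 / 4 : ℝ) • weight L e ^ 2) = 1 ↔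
      ∀ u, invDist (y u) (weight L e u / 2) = w u := by
    have hweight (u : Icc (0 : ℝ) L) : 0 < weight L e u / 2 :=
      half_pos (one_sub_mul_cos_pos he u)
    rw [DFunLike.ext_iff]
    refine forall_congr' fun u => ?_
    change w u ^ 2 * (y u ^ 2 + 1 / 4 * weight L e u ^ 2) = 1 ↔ _
    rw [show 1 / 4 * weight L e u ^ 2 = (weight L e u / 2) ^ 2 by ring]
    exact ⟨invDist_eq_of_sq_mul (hw u), fun h => h ▸ invDist_sq_mul (hweight u)⟩
  rw [bvp, Prod.mk_eq_zero, Prod.mk_eq_zero, sub_eq_zero, sub_eq_zero, and_left_comm, hdist]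
  refine and_congr_right fun hyw => ?_
  rw [eq_response_iff hL he hk (lipschitzWith_F he) hX fun t ht => ?_]
  · refine and_congr_right fun hyX => ?_
    rw [← hyX L ⟨hL, le_rfl⟩, hk, IccExtend_of_mem hL _ ⟨hL, le_rfl⟩]
    rfl
  · have hkt := (kepler_mem_Icc_iff he hk).2 ht
    rw [IccExtend_of_mem hL _ hkt, IccExtend_of_mem hL _ hkt, F_eq_force, force,
      ContinuousMap.mul_apply, ContinuousMap.pow_apply, ← hyw]
    congr 3
    exact one_div_mul_eq_div _ _

theorem fderiv_bvp_apply (y w a b : Curve L) (η β : ℝ) :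
    fderiv ℝ (bvp hL) (0, y, w, η) (0, a, b, β) =
      (a - response hL 0 β (a * w ^ 3 + y * (3 * w ^ 2 * b)),
        2 * w * b * (y ^ 2 + (1 / 4 : ℝ) • 1) + w ^ 2 * (2 * y * a), a ⟨L, hL, le_rfl⟩) := by
  have hline (c d : Curve L) : HasDerivAt (fun s : ℝ => c + s • d) d 0 := by
    simpa only [one_smul] using ((hasDerivAt_id' (0 : ℝ)).smul_const d).const_add c
  have hη : HasDerivAt (fun s : ℝ => (η + s * β) • (1 : Curve L)) (β • (1 : Curve L)) 0 := by
    simpa only [one_mul] using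
      (((hasDerivAt_id' (0 : ℝ)).mul_const β).const_add η).smul_const (1 : Curve L)
  have hy := hline y a
  have hw := hline w b
  have hforce := (primitive hL).hasFDerivAt.comp_hasDerivAt (0 : ℝ) (hy.fun_mul (hw.fun_pow 3))
  have hpos := hy.fun_sub ((primitive hL).hasFDerivAt.comp_hasDerivAt (0 : ℝ) (hη.fun_sub hforce))
  have hdist := ((hw.fun_pow 2).fun_mul ((hy.fun_pow 2).add_const ((1 / 4 : ℝ) • 1))).sub_const 1
  have hend := (ContinuousMap.evalCLM ℝ
    (⟨L, hL, le_rfl⟩ : Icc (0 : ℝ) L)).hasFDerivAt.comp_hasDerivAt (0 : ℝ) hy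
  have hdir := (((contDiff_bvp hL).differentiable (by simp))
    (0, y, w, η)).hasFDerivAt.hasLineDerivAt (0, a, b, β)
  refine HasDerivAt.unique hdir ?_
  convert! hpos.prodMk (hdist.prodMk hend) using 1
  · funext s
    simp [bvp, response, weight_zero]
  · simp [response, weight_zero]

theorem linearized_dist_eq_iff {A : Type*} [CommRing A] [Algebra ℝ A] {y w s : A}
    (h : w ^ 2 * s = 1) (a b g : A) : 2 * w * b * s + w ^ 2 * (2 * y * a) = g ↔
      b = (1 / 2 : ℝ) • (w * g) - w ^ 3 * y * a := by
  have htwo : 2 * algebraMap ℝ A (1 / 2) = 1 := by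
    rw [← map_ofNat (algebraMap ℝ A) 2, ← map_mul, mul_one_div_cancel two_ne_zero, map_one]
  rw [Algebra.smul_def]
  refine ⟨fun hg => ?_, fun hb => ?_⟩
  · linear_combination algebraMap ℝ A (1 / 2) * w * hg
      - (w ^ 2 * b * s + w ^ 3 * y * a) * htwo - b * h
  · rw [hb]
    linear_combination g * w ^ 2 * s * htwo + (g - 2 * w ^ 2 * y * a) * h

theorem isInvertible_fderiv_bvp {η : ℝ} {x ψ : ℝ → ℝ} (hx : Continuous x)
    (hψ : IsHillSolution (fun t => stiffness (x t) (1 / 2)) 0 1 ψ) (hne : ψ L ≠ 0) {y w : Curve L}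
    (hy : ∀ t : Icc (0 : ℝ) L, y t = x t)
    (hw : ∀ t : Icc (0 : ℝ) L, w t = invDist (x t) (1 / 2)) :
    (fderiv ℝ (bvp hL) (0, y, w, η) ∘L .inr ℝ ℝ (Curve L × Curve L × ℝ)).IsInvertible := by
  set D := fderiv ℝ (bvp hL) (0, y, w, η) ∘L .inr ℝ ℝ (Curve L × Curve L × ℝ)
  have hdist : w ^ 2 * (y ^ 2 + (1 / 4 : ℝ) • 1) = 1 := ContinuousMap.ext fun t => by
    change w t ^ 2 * (y t ^ 2 + 1 / 4 * 1) = 1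
    rw [hy, hw]
    linear_combination invDist_sq_mul (x := x t) one_half_pos
  set k : Curve L := w ^ 3 - 3 * y ^ 2 * w ^ 5 with hk
  have helim (a b g : Curve L) (hb : b = (1 / 2 : ℝ) • (w * g) - w ^ 3 * y * a) :
      a * w ^ 3 + y * (3 * w ^ 2 * b) = k * a + (1 / 2 : ℝ) • (3 * y * w ^ 3 * g) := by
    simp only [hb, hk, Algebra.smul_def]
    ring
  have hD a b β (f g : Curve L) c : D (a, b, β) = (f, g, c) ↔
      b = (1 / 2 : ℝ) • (w * g) - w ^ 3 * y * a ∧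
        a - response hL 0 β (k * a + (1 / 2 : ℝ) • (3 * y * w ^ 3 * g)) = f ∧
          a ⟨L, hL, le_rfl⟩ = c := by
    change fderiv ℝ (bvp hL) (0, y, w, η) (0, a, b, β) = _ ↔ _
    rw [fderiv_bvp_apply, Prod.mk.injEq, Prod.mk.injEq, and_left_comm, linearized_dist_eq_iff hdist]
    exact and_congr_right fun hb => by rw [helim a b g hb]
  have hbij : Bijective D := by
    refine (bijective_iff_existsUnique D).2 fun ⟨f, g, c⟩ => ?_
    obtain ⟨⟨a, β⟩, hsol, huniq⟩ := existsUnique_linear_bvp hL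
      (continuous_stiffness hx continuous_const fun _ => one_half_pos)
      (fun t => abs_stiffness_le one_half_pos) hψ hne (k := k)
      (fun t => by rw [stiffness, ← hw, ← hy]; rfl) f ((1 / 2 : ℝ) • (3 * y * w ^ 3 * g)) c
    refine ⟨(a, _, β), (hD _ _ _ _ _ _).2 ⟨rfl, hsol⟩, fun ⟨a', b', β'⟩ h => ?_⟩
    obtain ⟨hb', hsol'⟩ := (hD _ _ _ _ _ _).1 h
    obtain ⟨rfl, rfl⟩ := Prod.mk.inj (huniq (a', β') hsol')
    rw [hb']
  have hker := LinearMap.ker_eq_bot.2 hbij.injective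
  have hrange := LinearMap.range_eq_top.2 hbij.surjective
  exact ⟨.ofBijective D hker hrange, ContinuousLinearEquiv.coe_ofBijective D hker hrange⟩

end Curve

theorem exists_smooth_velocity {L η : ℝ} (hL : 0 ≤ L) {x ψ : ℝ → ℝ}
    (hk : ∀ e ∈ Ico (0 : ℝ) 1, kepler L e = L) (hx : IsSitnikovSolution 0 η x) (hxL : x L = 0)
    (hψ : IsHillSolution (fun t => stiffness (x t) (1 / 2)) 0 1 ψ) (hne : ψ L ≠ 0) :
    ∃ (ε : ℝ) (E : ℝ → ℝ), 0 < ε ∧ ε ≤ 1 ∧ ContDiffOn ℝ ∞ E (Ico 0 ε) ∧ E 0 = η ∧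
      ∀ e ∈ Ico 0 ε, ∀ X, IsSitnikovSolution e (E e) X → X L = 0 := by
  have hx_cont := hx.continuous
  have hdist_cont := continuous_invDist hx_cont continuous_const fun _ => one_half_pos
  let y : Curve L := ⟨fun t => x t, by fun_prop⟩
  let w : Curve L := ⟨fun t => invDist (x t) (1 / 2), hdist_cont.comp continuous_subtype_val⟩
  have hbase : bvp hL (0, y, w, η) = 0 := by
    refine (bvp_eq_zero_iff hL zero_mem_Ico_one (hk 0 zero_mem_Ico_one) hx
      fun u => invDist_pos one_half_pos).2 ⟨fun u => ?_, fun t ht => ?_, hxL⟩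
    · rw [weight_zero]
      rfl
    · rw [kepler_zero_right, IccExtend_of_mem hL _ ht]
      rfl
  have hsmooth : ContDiffAt ℝ ω (bvp hL) (0, y, w, η) := (contDiff_bvp hL).contDiffAt
  have hinv := isInvertible_fderiv_bvp hL (η := η) hx_cont hψ hne (y := y) (w := w)
    (fun _ => rfl) fun _ => rfl
  have hω : (ω : WithTop ℕ∞) ≠ 0 := by simp
  set Ψ := hsmooth.implicitFunction hω hinv
  have hΨ0 : Ψ 0 = (y, w, η) := hsmooth.implicitFunction_apply_self hω hinv
  have hΨsmooth : ContDiffAt ℝ ω Ψ 0 := hsmooth.contDiffAt_implicitFunction hω hinv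
  have hΨzero := hsmooth.eventually_apply_implicitFunction hω hinv
  have hdist_pos : ∀ᶠ e in 𝓝 0, MapsTo (Ψ e).2.1 univ (Ioi 0) :=
    hΨsmooth.continuousAt.snd.fst.eventually_mem
      ((ContinuousMap.isOpen_setOfPred_mapsTo isCompact_univ isOpen_Ioi).mem_nhds
        (hΨ0 ▸ fun _ _ => invDist_pos one_half_pos))
  obtain ⟨δ, hδ, hΨ⟩ := Metric.eventually_nhds_iff.1
    (hΨzero.and ((hΨsmooth.eventually (by simp)).and hdist_pos))
  have hmem e (he : e ∈ Ico 0 (min δ 1)) : dist e 0 < δ := by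
    rw [Real.dist_eq, sub_zero, abs_of_nonneg he.1]
    exact he.2.trans_le (min_le_left _ _)
  refine ⟨min δ 1, fun e => (Ψ e).2.2, lt_min hδ one_pos, min_le_right _ _, fun e he => ?_,
    congrArg (fun z => z.2.2) hΨ0, fun e he X hX => ?_⟩
  · exact ((hΨ (hmem e he)).2.1.snd.snd.of_le le_top).contDiffWithinAt
  · obtain ⟨hzero, -, hpos⟩ := hΨ (hmem e he)
    have he' : e ∈ Ico (0 : ℝ) 1 := ⟨he.1, he.2.trans_le (min_le_right _ _)⟩
    exact ((bvp_eq_zero_iff hL he' (hk e he') hX fun u => hpos (mem_univ u)).1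
      (hzero.trans hbase)).2.2

theorem exists_isHillSolution {q : ℝ → ℝ} {C : ℝ} (hq : Continuous q) (hC : ∀ t, |q t| ≤ C)
    (a v : ℝ) : ∃ ψ, IsHillSolution q a v ψ := by
  simpa only [IsLinearSolution, add_zero] using
    exists_isLinearSolution hq hC continuous_const (fun _ => abs_zero.le) a v

theorem exists_isHillTrace_potential {e η : ℝ} {φ : ℝ → ℝ → ℝ} (he : e ∈ Ico (0 : ℝ) 1)
    (hφ : IsSitnikovSolution e η (φ · e)) (T : ℝ) : ∃ τ, IsHillTrace (potential φ e) T τ := by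
  have hbound t : |stiffness (φ t e) (r t e)| ≤ 2 * ((1 - e) / 2)⁻¹ ^ 3 := by
    have hpos : 0 < (1 - e) / 2 := half_pos (sub_pos.2 he.2)
    have hr_pos := r_pos he t
    have hr := half_one_sub_le_r he t
    exact (abs_stiffness_le hr_pos).trans (by gcongr)
  rw [funext (potential_eq he φ)]
  obtain ⟨ψ₁, hψ₁⟩ := exists_isHillSolution (hφ.continuous_stiffness he) hbound 1 0
  obtain ⟨ψ₂, hψ₂⟩ := exists_isHillSolution (hφ.continuous_stiffness he) hbound 0 1
  exact ⟨_, ψ₁, ψ₂, hψ₁, hψ₂, rfl⟩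

theorem exists_isTraceAlong {m p : ℕ} {ε : ℝ} {E : ℝ → ℝ} {φ : ℝ → ℝ → ℝ}
    (H : IsOddFamily m p ε E φ) : ∃ τ, IsTraceAlong m ε φ τ := by
  choose! τ hτ using fun e (he : e ∈ Ico 0 ε) =>
    exists_isHillTrace_potential ⟨he.1, he.2.trans_le H.eps_le_one⟩ (H.solution e he)
      (2 * m * Real.pi)
  exact ⟨τ, hτ⟩

theorem exists_smooth_velocity_of_antiperiodic {η S : ℝ} {x : ℝ → ℝ} {m p : ℕ} (hp : p ≠ 0)
    (hη : η ≠ 0) (hx : IsSitnikovSolution 0 η x) (hS0 : 0 < S) (hS : Antiperiodic x S)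
    (hpos : ∀ t ∈ Ioo 0 S, 0 < x t) (hpS : p * S = m * Real.pi) :
    ∃ (ε : ℝ) (E : ℝ → ℝ), 0 < ε ∧ ε ≤ 1 ∧ ContDiffOn ℝ ∞ E (Ico 0 ε) ∧ E 0 = η ∧
      ∀ e ∈ Ico 0 ε, ∀ X, IsSitnikovSolution e (E e) X → X (m * Real.pi) = 0 := by
  obtain ⟨ψ, hψ⟩ := exists_isHillSolution
    (continuous_stiffness hx.continuous continuous_const fun _ => one_half_pos)
    (fun _ => abs_stiffness_le one_half_pos) 0 1
  have hzero : x (p * S) = 0 := by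
    rw [← zero_add (p * S), hS.add_nat_mul_eq, hx.init_pos, mul_zero]
  have hψne := hx.hillSolution_ne_zero hη hS0 hS hpos hψ hp
  rw [hpS] at hzero hψne
  exact exists_smooth_velocity (by positivity) (fun e he => (kepler_eq_iff he).2 (by simp))
    hx hzero hψ hψne

theorem exists_isOddFamily {m p : ℕ} (hp : p ≠ 0) (hpm : p < Real.sqrt 8 * m) :
    ∃ ε E φ, IsOddFamily m p ε E φ := by
  have hp' : (0 : ℝ) < p := by positivity
  have hm : (0 : ℝ) < m := pos_of_mul_pos_right (hp'.trans hpm) (Real.sqrt_nonneg 8)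
  set S : ℝ := m * Real.pi / p with hS_def
  have hS0 : 0 < S := by positivity
  have hS8 : Real.pi ^ 2 < 8 * S ^ 2 := by
    have hsq := pow_lt_pow_left₀ hpm hp'.le two_ne_zero
    rw [mul_pow, Real.sq_sqrt (by positivity)] at hsq
    rw [hS_def, div_pow, mul_pow, ← mul_div_assoc, lt_div_iff₀ (by positivity), ← mul_assoc,
      mul_comm]
    exact mul_lt_mul_of_pos_right hsq (by positivity)
  obtain ⟨η, x, hη, hx, hS, hpos⟩ := exists_antiperiodic_pos hS0 hS8
  obtain ⟨ε, E, hε, hε1, hE, hE0, hboundary⟩ := exists_smooth_velocity_of_antiperiodic hp hη.ne'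
    hx hS0 hS hpos (mul_div_cancel₀ (m * Real.pi) hp'.ne')
  choose! X hX using fun e (he : e ∈ Ico 0 ε) =>
    exists_isSitnikovSolution ⟨he.1, he.2.trans_le hε1⟩ (E e)
  have h0 : (0 : ℝ) ∈ Ico 0 ε := left_mem_Ico.2 hε
  have hX0 : X 0 = x := IsSitnikovSolution.ext_of_eq_at zero_mem_Ico_one (hX 0 h0) hx (c := 0)
    ((hX 0 h0).init_pos.trans hx.init_pos.symm)
    ((hX 0 h0).init_vel.trans (hE0.trans hx.init_vel.symm))
  refine ⟨ε, E, fun t e => X e t, hε, hε1, hE, hX, fun e he => hboundary e he _ (hX e he),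
    hE0 ▸ hη, ?_⟩
  rw [hX0]
  convert hx.isMinimalPeriod hη hS0 hS hpos using 1
  rw [hS_def]
  ring

theorem cast_lt_of_le_floor_sqrt_eight_mul {m p : ℕ} (hm : m ≠ 0)
    (h : p ≤ ⌊Real.sqrt 8 * m⌋₊) : p < Real.sqrt 8 * m := by
  have hirr : Irrational (Real.sqrt 8 * m) :=
    (irrational_sqrt_ofNat_iff.2 (by norm_num)).mul_natCast hm
  exact lt_of_le_of_ne ((Nat.le_floor_iff (by positivity)).1 h) (hirr.ne_nat p).symm

theorem exists_ratio_eq_of_dvd {m p : ℕ} (hm : m ≠ 0) (h : 2 * p ∣ m) :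
    ∃ n : ℕ, 1 ≤ n ∧ (p : ℝ) / m = 1 / (2 * n) := by
  obtain ⟨n, rfl⟩ := h
  obtain ⟨hp, hn⟩ := mul_ne_zero_iff.1 hm
  refine ⟨n, Nat.one_le_iff_ne_zero.2 hn, ?_⟩
  have : (p : ℝ) ≠ 0 := by exact_mod_cast right_ne_zero_of_mul hp
  push_cast
  field_simp

end

end Sitnikov

theorem theorem4p1 (m p : ℕ) (hp : 1 ≤ p) (hpm : p ≤ ⌊Real.sqrt 8 * (m : ℝ)⌋₊) :
    (∃ (ε : ℝ) (E : ℝ → ℝ) (φ : ℝ → ℝ → ℝ) (τ : ℝ → ℝ),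
      Sitnikov.IsOddFamily m p ε E φ ∧ Sitnikov.IsTraceAlong m ε φ τ) ∧
    ((∀ n : ℕ, 1 ≤ n → (p : ℝ) / (m : ℝ) ≠ 1 / (2 * (n : ℝ))) →
      Sitnikov.TraceDerivVanishes m p) ∧
    (Odd m → Sitnikov.TraceDerivVanishes m p) ∧
    (Even m → m / 2 + 1 ≤ p → Sitnikov.TraceDerivVanishes m p) := by
  have hp0 : p ≠ 0 := Nat.one_le_iff_ne_zero.1 hp
  have hm : m ≠ 0 := by
    rintro rfl
    simp_all
  obtain ⟨ε, E, φ, H⟩ := Sitnikov.exists_isOddFamily hp0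
    (Sitnikov.cast_lt_of_le_floor_sqrt_eight_mul hm hpm)
  obtain ⟨τ, hτ⟩ := Sitnikov.exists_isTraceAlong H
  refine ⟨⟨ε, E, φ, τ, H, hτ⟩, fun hratio => ?_, fun hodd => ?_, fun _ hmp => ?_⟩ <;>
    refine Sitnikov.traceDerivVanishes_of_not_dvd hp0 fun hdvd => ?_
  · obtain ⟨n, hn, h⟩ := Sitnikov.exists_ratio_eq_of_dvd hm hdvd
    exact hratio n hn h
  · exact Nat.not_even_iff_odd.2 hodd (even_iff_two_dvd.2 (dvd_of_mul_right_dvd hdvd))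
  · have := Nat.le_of_dvd (Nat.pos_of_ne_zero hm) hdvd
    omega
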